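/- Consider the four string diagrams on nodes $0,\dots,4$ with node labels $$(a)\ (1,2,2,4,4),\qquad (b)\ (1,2,2,1,1),\qquad (c)\ (2,1,1,2,2),\qquad (d)\ (4,2,2,1,1),$$ which encode the four basic systems of the crystallographic Coxeter group $G=[4,3,4,3]$. For a diagram with labels $a_0,\dots,a_4$, let $r_0,\dots,r_4\in GL_5(\mathbb Z)$ be the reflections $r_i(b_j)=b_j+m_{ij}b_i$ on $\bigoplus_j\mathbb Z b_j$, where $m_{ii}=-2$, $m_{ij}=\max(1,a_j/a_i)$ if $|i-j|=1$, and $m_{ij}=0$ if $|i-j|\ge 2$; let $G=\langle r_0,\dots,r_4\rangle$, and for an integer $d\geq 2$ let $G^d=\langle r_0,\dots,r_4\rangle^d\subseteq GL_5(\mathbb Z_d)$ be its reduction modulo $d$. A group with distinguished generators $\rho_0,\dots,\rho_{n-1}$ is a string C-group if the $\rho_i$ are involutions, $\rho_i$ and $\rho_j$ commute for $|i-j|\ge2$, and $\langle\rho_i: i\in I\rangle\cap\langle\rho_i: i\in J\rangle=\langle\rho_i: i\in I\cap J\rangle$ for all $I,J\subseteq\{0,\dots,n-1\}$. For a group $\Gamma$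 with distinguished generators $\rho_0,\dots,\rho_{n-1}$, let $\mathcal P(\Gamma)$ be the set whose faces of rank $j$ ($-1\le j\le n$) are the left cosets of $\langle\rho_i: i\ne j\rangle$, a face of rank $j$ being below a face of rank $k$ if and only if $j\le k$ and the two cosets meet. For $\mathbf q\in\mathbb Z^3$, the cubic toroid $\{4,3,4\}_{\mathbf q}$ is the quotient of the tessellation of $3$-space by unit cubes with vertex set $\mathbb Z^3$ by the group of translations generated by $\mathbf q$ and all its images under permutations and sign changes of the coordinates (with a least and a greatest face adjoined), and $\{3,4,3\}$ is the $24$-cell, that is, $\mathcal P$ of the Coxeter group $[3,4,3]$ of type $F_4$ with its standard generators. Let $d>2$. Then for each of the four diagrams the following hold. 1. $G^d$, with the generators $r_0,\dots,r_4$ modulo $d$, is a string C-group. 2. $\mathcal P(G^d)$ is a finite abstract regular $5$-polytope, and $G^d$, acting by left multiplication on cosets, is its full automorphism group. 3. $\mathcal P(G^d)$ is locally toroidal of type $\{\{4,3,4\}_{\mathbf q},\{3,4,3\}\}$, that is, all its facets are isomorphic to $\{4,3,4\}_{\mathbf q}$ and all its vertex-figures are isomorphic to $\{3,4,3\}$,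 where $\mathbf q=(d,d,0)$ for diagram $(d)$ with $d$ even, and $\mathbf q=(d,0,0)$ in all other cases. Moreover, if $d$ is odd, then the groups $G^d$ for any two of the four diagrams are isomorphic; indeed they are conjugate in $GL_5(\mathbb Z_d)$ by an element that carries each generator $r_i$ of one to the generator $r_i$ of the other. -/

import Mathlib

/-! ### Abstract polytopes -/

/-- Two flags (maximal chains) are adjacent if they differ in exactly one face. -/
def flagGraph (P : Type*) [LE P] : SimpleGraph (Flag P) where
  Adj Φ Ψ := ((Φ : Set P) \ (Ψ : Set P)).ncard = 1 ∧ ((Ψ : Set P) \ (Φ : Set P)).ncard = 1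
  symm := ⟨fun _ _ h => ⟨h.2, h.1⟩⟩
  loopless := ⟨fun Φ h => by simp at h⟩

/-- `P`, with the rank function `rk`, is an abstract `n`-polytope. -/
structure IsAbstractPolytope (n : ℕ) (P : Type*) [LE P] (rk : P → ℤ) : Prop where
  partialOrder : IsPartialOrder P (fun F G => F ≤ G)
  rk_strictMono : ∀ F G : P, F ≤ G → F ≠ G → rk F < rk G
  rk_range : Set.range rk = Set.Icc (-1) (n : ℤ)
  least : ∃ F : P, rk F = -1 ∧ ∀ G : P, F ≤ G
  greatest : ∃ F : P, rk F = n ∧ ∀ G : P, G ≤ F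
  flag_card : ∀ Φ : Flag P, (Φ : Set P).ncard = n + 2
  /-- homogeneity (the diamond condition) -/
  diamond : ∀ F G : P, F ≤ G → rk G = rk F + 2 →
    {H : P | F ≤ H ∧ H ≤ G ∧ rk H = rk F + 1}.ncard = 2
  /-- strong flag-connectedness: the flag graph of every section `G/F` is connected -/
  connected : ∀ F G : P, F ≤ G → (flagGraph {H : P // F ≤ H ∧ H ≤ G}).Connected

/-- An abstract polytope is regular if its automorphism group is transitive on flags. -/
structure IsRegularPolytope (n : ℕ) (P : Type*) [LE P] (rk : P → ℤ) : Prop extends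
    IsAbstractPolytope n P rk where
  flag_transitive : ∀ Φ Ψ : Flag P, ∃ f : P ≃o P, f '' (Φ : Set P) = (Ψ : Set P)

/-- All facets of the `n`-polytope `P` are isomorphic to `P₁` and all its vertex-figures are
isomorphic to `P₂`. -/
def HasFacetsAndVertexFigures (n : ℕ) (P : Type*) [LE P] (rk : P → ℤ)
    (P₁ P₂ : Type*) [LE P₁] [LE P₂] : Prop :=
  (∀ F : P, rk F = (n : ℤ) - 1 → Nonempty ({H : P // H ≤ F} ≃o P₁)) ∧
  (∀ F : P, rk F = 0 → Nonempty ({H : P // F ≤ H} ≃o P₂))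

/-! ### String C-groups and their polytopes -/

/-- The group `Γ` with the distinguished generators `ρ₀, …, ρₙ₋₁` is a string C-group. -/
structure IsStringCGroup {n : ℕ} {Γ : Type*} [Group Γ] (ρ : Fin n → Γ) : Prop where
  generate : Subgroup.closure (Set.range ρ) = ⊤
  involution : ∀ i, orderOf (ρ i) = 2
  commute : ∀ i j : Fin n, (i : ℕ) + 2 ≤ j → Commute (ρ i) (ρ j)
  intersection : ∀ I J : Set (Fin n),
    Subgroup.closure (ρ '' I) ⊓ Subgroup.closure (ρ '' J) = Subgroup.closure (ρ '' (I ∩ J))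

/-- The standard subgroup for faces of rank `j - 1`, generated by all `ρᵢ` with `i ≠ j - 1`.
It is the group generated by all `ρᵢ` for the improper ranks `-1` and `n`. -/
def faceSubgroup {n : ℕ} {Γ : Type*} [Group Γ] (ρ : Fin n → Γ) (j : Fin (n + 2)) : Subgroup Γ :=
  Subgroup.closure (ρ '' {i | (i : ℕ) + 1 ≠ j})

/-- The faces of `𝒫(Γ)`: left cosets of the standard subgroups, tagged by their rank plus `1`. -/
@[ext]
structure CosetFace {n : ℕ} {Γ : Type*} [Group Γ] (ρ : Fin n → Γ) where
  idx : Fin (n + 2)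
  coset : Γ ⧸ faceSubgroup ρ idx

/-- The rank of a face of `𝒫(Γ)`, a number in `{-1, 0, …, n}`. -/
def CosetFace.rk {n : ℕ} {Γ : Type*} [Group Γ] {ρ : Fin n → Γ} (F : CosetFace ρ) : ℤ :=
  (F.idx : ℕ) - 1

/-- Incidence in `𝒫(Γ)`: the ranks are in order and the cosets meet. -/
instance {n : ℕ} {Γ : Type*} [Group Γ] (ρ : Fin n → Γ) : LE (CosetFace ρ) where
  le F G := F.idx ≤ G.idx ∧
    ∃ g : Γ, (g : Γ ⧸ faceSubgroup ρ F.idx) = F.coset ∧ (g : Γ ⧸ faceSubgroup ρ G.idx) = G.coset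

/-- The 24-cell `{3,4,3}`, the polytope of the Coxeter group `[3,4,3]` of type `F₄`. -/
abbrev Cell24 : Type := CosetFace CoxeterMatrix.F₄.simple

/-! ### Cubic toroids -/

/-- A (proper) face of the tessellation of `m`-space by unit cubes with vertex set `ℤᵐ`: the cube
`∏ᵢ [baseᵢ, baseᵢ + εᵢ]`, where `εᵢ = 1` for `i ∈ dirs` and `εᵢ = 0` otherwise. -/
@[ext]
structure CubeCell (m : ℕ) where
  base : Fin m → ℤ
  dirs : Finset (Fin m)

/-- The corner of a cell opposite to `base`. -/
def CubeCell.corner {m : ℕ} (C : CubeCell m) : Fin m → ℤ :=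
  fun i => C.base i + if i ∈ C.dirs then 1 else 0

/-- Inclusion of cells. -/
instance (m : ℕ) : LE (CubeCell m) where
  le C E := E.base ≤ C.base ∧ C.corner ≤ E.corner

/-- The lattice spanned by the vector `q` and all its images under permutations and sign changes
of the coordinates. -/
def typeLattice {m : ℕ} (q : Fin m → ℤ) : AddSubgroup (Fin m → ℤ) :=
  AddSubgroup.closure
    {x | ∃ (σ : Equiv.Perm (Fin m)) (ε : Fin m → ℤˣ), x = fun i => (ε i : ℤ) * q (σ i)}

/-- Equivalence of cells under the translations in the lattice of `q`. -/
def cellSetoid {m : ℕ} (q : Fin m → ℤ) : Setoid (CubeCell m) where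
  r C E := C.dirs = E.dirs ∧ E.base - C.base ∈ typeLattice q
  iseqv :=
    { refl := fun C => ⟨rfl, by simp [(typeLattice q).zero_mem]⟩
      symm := fun {C E} h => ⟨h.1.symm, by
        have := (typeLattice q).neg_mem h.2
        rwa [neg_sub] at this⟩
      trans := fun {C E F} h h' => ⟨h.1.trans h'.1, by
        have := (typeLattice q).add_mem h'.2 h.2
        rwa [sub_add_sub_cancel] at this⟩ }

/-- The proper faces of the cubic toroid `{4,3ᵐ⁻²,4}_q`: translation classes of cells. -/
def ToroidCell {m : ℕ} (q : Fin m → ℤ) : Type := Quotient (cellSetoid q)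

/-- Two classes of cells are incident if they have incident representatives. -/
instance {m : ℕ} (q : Fin m → ℤ) : LE (ToroidCell q) where
  le x y := ∃ C E : CubeCell m,
    Quotient.mk (cellSetoid q) C = x ∧ Quotient.mk (cellSetoid q) E = y ∧ C ≤ E

/-- The cubic toroid `{4,3ᵐ⁻²,4}_q`, with its improper least and greatest faces: the quotient of
the cubical tessellation of `m`-space by the lattice of `q`. -/
abbrev CubicToroid {m : ℕ} (q : Fin m → ℤ) : Type := WithBot (WithTop (ToroidCell q))

/-! ### Crystallographic string Coxeter groups and modular reduction -/

/-- The Cartan integers of the basic system whose string diagram (with single branches between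
consecutive nodes) has the node labels `a j = b_j · b_j`: adjacent nodes `i, j` labelled `a, ka`
(`k ≥ 1`) have `m_{ij} = k` and `m_{ji} = 1`. -/
def cartanInt {n : ℕ} (a : Fin n → ℕ) (i j : Fin n) : ℤ :=
  if i = j then -2
  else if (i : ℕ) + 1 = j ∨ (j : ℕ) + 1 = i then ((max 1 (a j / a i) : ℕ) : ℤ)
  else 0

/-- The matrix, in the basis `b_0, …, b_{n-1}`, of the reflection `r_i(b_j) = b_j + m_{ij} b_i`. -/
def reflMatrix {n : ℕ} (a : Fin n → ℕ) (i : Fin n) : Matrix (Fin n) (Fin n) ℤ :=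
  1 + Matrix.vecMulVec (Pi.single i 1) (cartanInt a i)

theorem reflMatrix_mul_self {n : ℕ} (a : Fin n → ℕ) (i : Fin n) :
    reflMatrix a i * reflMatrix a i = 1 := by
  have h : Matrix.vecMulVec (Pi.single i (1 : ℤ)) (cartanInt a i) *
      Matrix.vecMulVec (Pi.single i (1 : ℤ)) (cartanInt a i) =
      (-2 : ℤ) • Matrix.vecMulVec (Pi.single i (1 : ℤ)) (cartanInt a i) := by
    rw [Matrix.vecMulVec_mul_vecMulVec]
    have hii : cartanInt a i i = -2 := by simp [cartanInt]
    ext k l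
    simp only [dotProduct_single, hii, Matrix.vecMulVec_apply, Matrix.smul_apply, Pi.smul_apply,
      smul_eq_mul]
    ring
  simp only [reflMatrix, mul_add, add_mul, h, one_mul, mul_one]
  module

/-- The reflection `r_i` as an element of `GLₙ(ℤ)`. -/
def rootReflection {n : ℕ} (a : Fin n → ℕ) (i : Fin n) : Matrix.GeneralLinearGroup (Fin n) ℤ :=
  ⟨reflMatrix a i, reflMatrix a i, reflMatrix_mul_self a i, reflMatrix_mul_self a i⟩

/-- The crystallographic linear group `G = ⟨r_0, …, r_{n-1}⟩`. -/
def linGroup {n : ℕ} (a : Fin n → ℕ) : Subgroup (Matrix.GeneralLinearGroup (Fin n) ℤ) :=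
  Subgroup.closure (Set.range (rootReflection a))

/-- Entrywise reduction `GLₙ(ℤ) → GLₙ(ℤ_d)`. -/
def reduce (n d : ℕ) :
    Matrix.GeneralLinearGroup (Fin n) ℤ →* Matrix.GeneralLinearGroup (Fin n) (ZMod d) :=
  Matrix.GeneralLinearGroup.map (Int.castRingHom (ZMod d))

/-- The modular reduction `G^d` of `G`. -/
def modGroup {n : ℕ} (a : Fin n → ℕ) (d : ℕ) :
    Subgroup (Matrix.GeneralLinearGroup (Fin n) (ZMod d)) :=
  (linGroup a).map (reduce n d)

/-- The images in `G^d` of the generators `r_i`. -/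
def modGen {n : ℕ} (a : Fin n → ℕ) (d : ℕ) (i : Fin n) : modGroup a d :=
  ⟨reduce n d (rootReflection a i),
    Subgroup.mem_map_of_mem _ (Subgroup.subset_closure (Set.mem_range_self i))⟩

/-- The names of the four basic systems of the group `[4,3,4,3]`. -/
inductive BasicSystem
  | a | b | c | d
  deriving DecidableEq

/-- The node labels of the diagrams of the four basic systems of `[4,3,4,3]`. -/
def BasicSystem.labels : BasicSystem → Fin 5 → ℕ
  | .a => ![1, 2, 2, 4, 4]
  | .b => ![1, 2, 2, 1, 1]
  | .c => ![2, 1, 1, 2, 2]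
  | .d => ![4, 2, 2, 1, 1]

/-- The type vector of the facets for the modulus `d`. -/
def BasicSystem.typeVector (D : BasicSystem) (d : ℕ) : Fin 3 → ℤ :=
  if D = .d ∧ Even d then ![d, d, 0] else ![d, 0, 0]

/-! The proof separates general facts about string C-groups from arithmetic special to `[4,3,4,3]`.

General part. The generator `ρ i` moves only the face of index `i + 1` (rank `i`) of the base flag.
Since distant generators commute, the stabilizer of a base face is the product of a group fixing all
lower faces and a group fixing all higher ones, so every chain of cosets has a common representative
(`exists_common`). With the intersection property this gives the diamond condition, connectedness
and the identification of the group with the automorphism group (`isRegularPolytope`,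
`automorphismEquiv`). The intersection property itself only has to be tested on pairs of intervals
`[k,l)`, `(k,l]` of generators (`closure_inf_closure_of_intervals`).

Intersection property and vertex-figures. A reflection `r_i` changes a row vector `y` by a multiple
of `y_i`, so the row vector `e_l` is fixed by every generator except `r_l`. An element of both
interval groups therefore fixes `e_l`, and it involves only `r_1, …, r_4`, so it is the image of an
element of the Coxeter group `F₄`. Explicit coset representatives show that every nontrivial coset
moves `e_l` by a vector having a coordinate `±1` or `±2`, which is nonzero modulo `d > 2`
(`exists_rowWord_sub`). Hence the element already lies in the smaller parabolic subgroup
(`mem_closure_of_single_vecMul`). Descending through `l`, the same argument shows that `F₄` embeds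
in `G^d` (`vertexHom_injective`), so the vertex-figures are 24-cells.

Facets. After rescaling the basis, `r_0, …, r_3` act as the symmetries of the cubical tessellation
on a lattice containing an isotropic vector (`embed_reflMatrix`). A symmetry trivial modulo `d > 2`
has trivial linear part, because signed permutations have entries in `{-1, 0, 1}`. A translation by
`v` is trivial exactly if `v = d c` and one further entry, quadratic in `c`, is divisible by `d`
(`facetHom_trans_eq_one_iff`). That entry imposes a condition only for diagram (d) with `d` even,
where it says that `c 0 + c 1 + c 2` is even; this is the lattice of `(d,d,0)`. Cells are then
matched with cosets through the orbit and stabilizer of their centers (`nonempty_facet_iso`).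

Odd moduli. The four basic systems differ by rescaling roots by `1` or `2`, and a diagonal matrix
with these entries is invertible modulo an odd number (`exists_conj`). -/

/-! ### Subgroups generated by involutions -/

section Closure

variable {ι Γ : Type*} [Group Γ] {ρ : ι → Γ}

/-- Generators that are involutions are their own inverses, so the inverse step of the usual
induction disappears. -/
theorem closure_image_induction_right {S : Set ι} (hinv : ∀ i, ρ i * ρ i = 1) {p : Γ → Prop}
    (one : p 1) (mul : ∀ x ∈ Subgroup.closure (ρ '' S), ∀ i ∈ S, p x → p (x * ρ i)) {x : Γ}
    (hx : x ∈ Subgroup.closure (ρ '' S)) : p x := by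
  induction hx using Subgroup.closure_induction_right with
  | one => exact one
  | mul_right x hx y hy ih =>
    obtain ⟨i, hi, rfl⟩ := hy
    exact mul x hx i hi ih
  | mul_inv_cancel x hx y hy ih =>
    obtain ⟨i, hi, rfl⟩ := hy
    rw [inv_eq_of_mul_eq_one_right (hinv i)]
    exact mul x hx i hi ih

theorem closure_image_induction_left {S : Set ι} (hinv : ∀ i, ρ i * ρ i = 1) {p : Γ → Prop}
    (one : p 1) (mul : ∀ x ∈ Subgroup.closure (ρ '' S), ∀ i ∈ S, p x → p (ρ i * x)) {x : Γ}
    (hx : x ∈ Subgroup.closure (ρ '' S)) : p x := by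
  have key : p (x⁻¹)⁻¹ := by
    refine closure_image_induction_right (p := fun y => p y⁻¹) hinv (by simpa using one) ?_
      (inv_mem hx)
    intro y hy i hi hp
    rw [mul_inv_rev, inv_eq_of_mul_eq_one_right (hinv i)]
    exact mul _ (inv_mem hy) i hi hp
  simpa using key

theorem mem_closure_image_of_mem {S : Set ι} {i : ι} (hi : i ∈ S) : ρ i ∈ Subgroup.closure (ρ '' S) :=
  Subgroup.subset_closure (Set.mem_image_of_mem _ hi)

theorem closure_image_mono {S T : Set ι} (h : S ⊆ T) :
    Subgroup.closure (ρ '' S) ≤ Subgroup.closure (ρ '' T) :=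
  Subgroup.closure_mono (Set.image_mono h)

theorem commute_of_mem_closure_image_of_mem {X Y : Set ι} (h : ∀ i ∈ X, ∀ j ∈ Y, Commute (ρ i) (ρ j))
    {x y : Γ} (hx : x ∈ Subgroup.closure (ρ '' X)) (hy : y ∈ Subgroup.closure (ρ '' Y)) :
    Commute x y := by
  have hX : Subgroup.closure (ρ '' X) ≤ Subgroup.centralizer (Subgroup.closure (ρ '' Y) : Set Γ) := by
    rw [Subgroup.centralizer_closure, Subgroup.closure_le]
    rintro _ ⟨i, hi, rfl⟩
    rw [SetLike.mem_coe, Subgroup.mem_centralizer_iff]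
    rintro _ ⟨j, hj, rfl⟩
    exact (h i hi j hj).symm
  exact ((Subgroup.mem_centralizer_iff.1 (hX hx)) y hy).symm

/-- If the generators in `X` commute with those in `Y`, then the group generated by both is the
product of the groups generated by each. -/
theorem exists_mul_of_mem_closure_union {X Y : Set ι}
    (h : ∀ i ∈ X, ∀ j ∈ Y, Commute (ρ i) (ρ j)) {g : Γ}
    (hg : g ∈ Subgroup.closure (ρ '' (X ∪ Y))) :
    ∃ x ∈ Subgroup.closure (ρ '' X), ∃ y ∈ Subgroup.closure (ρ '' Y), g = x * y := by
  induction hg using Subgroup.closure_induction with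
  | mem g hg =>
    obtain ⟨i, hi | hi, rfl⟩ := hg
    · exact ⟨_, mem_closure_image_of_mem hi, 1, one_mem _, by simp⟩
    · exact ⟨1, one_mem _, _, mem_closure_image_of_mem hi, by simp⟩
  | one => exact ⟨1, one_mem _, 1, one_mem _, by simp⟩
  | mul a b _ _ iha ihb =>
    obtain ⟨x, hx, y, hy, rfl⟩ := iha
    obtain ⟨x', hx', y', hy', rfl⟩ := ihb
    refine ⟨x * x', mul_mem hx hx', y * y', mul_mem hy hy', ?_⟩
    have := (commute_of_mem_closure_image_of_mem h hx' hy).eq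
    calc x * y * (x' * y') = x * (y * x') * y' := by group
      _ = x * (x' * y) * y' := by rw [this]
      _ = _ := by group
  | inv a _ iha =>
    obtain ⟨x, hx, y, hy, rfl⟩ := iha
    refine ⟨x⁻¹, inv_mem hx, y⁻¹, inv_mem hy, ?_⟩
    rw [(commute_of_mem_closure_image_of_mem h hx hy).eq, mul_inv_rev]

end Closure

/-! ### The coset geometry of a string group -/

namespace CosetFace

variable {n : ℕ} {Γ : Type*} [Group Γ] {ρ : Fin n → Γ}

/-- The face with index `j` (that is, of rank `j - 1`) represented by `g`. -/
def of (ρ : Fin n → Γ) (g : Γ) (j : Fin (n + 2)) : CosetFace ρ :=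
  ⟨j, (g : Γ ⧸ faceSubgroup ρ j)⟩

@[simp] theorem of_idx (g : Γ) (j : Fin (n + 2)) : (of ρ g j).idx = j := rfl

theorem of_eq_of_iff {g h : Γ} {j : Fin (n + 2)} :
    of ρ g j = of ρ h j ↔ g⁻¹ * h ∈ faceSubgroup ρ j := by
  rw [← QuotientGroup.eq]
  constructor
  · intro H
    have := (CosetFace.mk.injEq _ _ _ _).mp H
    exact eq_of_heq this.2
  · intro H
    simp only [of, H]

theorem of_mul_eq {g h : Γ} {j : Fin (n + 2)} (hh : h ∈ faceSubgroup ρ j) :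
    of ρ (g * h) j = of ρ g j := by
  rw [eq_comm, of_eq_of_iff]
  simpa using hh

theorem exists_eq_of (F : CosetFace ρ) : ∃ g, F = of ρ g F.idx := by
  obtain ⟨j, x⟩ := F
  obtain ⟨g, rfl⟩ := QuotientGroup.mk_surjective x
  exact ⟨g, rfl⟩

theorem coset_eq_iff {F : CosetFace ρ} {g : Γ} :
    (g : Γ ⧸ faceSubgroup ρ F.idx) = F.coset ↔ F = of ρ g F.idx := by
  obtain ⟨j, x⟩ := F
  constructor
  · intro H
    change (g : Γ ⧸ faceSubgroup ρ j) = x at H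
    subst H
    rfl
  · intro H
    have := (CosetFace.mk.injEq _ _ _ _).mp H
    exact (eq_of_heq this.2).symm

theorem le_iff {F G : CosetFace ρ} :
    F ≤ G ↔ F.idx ≤ G.idx ∧ ∃ g, F = of ρ g F.idx ∧ G = of ρ g G.idx := by
  change (F.idx ≤ G.idx ∧ ∃ g : Γ, _) ↔ _
  simp only [coset_eq_iff]

theorem of_le_of {g : Γ} {j k : Fin (n + 2)} (h : j ≤ k) : of ρ g j ≤ of ρ g k :=
  le_iff.2 ⟨h, g, rfl, rfl⟩

theorem of_le_iff {g : Γ} {j : Fin (n + 2)} {G : CosetFace ρ} :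
    of ρ g j ≤ G ↔ j ≤ G.idx ∧ ∃ x, of ρ g j = of ρ x j ∧ G = of ρ x G.idx := le_iff

theorem eq_of_le_of_idx_eq {F G : CosetFace ρ} (h : F ≤ G) (hi : F.idx = G.idx) : F = G := by
  obtain ⟨-, g, hF, hG⟩ := le_iff.1 h
  rw [hF, hG, hi]

theorem le_refl (F : CosetFace ρ) : F ≤ F := by
  obtain ⟨g, hg⟩ := F.exists_eq_of
  exact le_iff.2 ⟨_root_.le_refl _, g, hg, hg⟩

theorem le_antisymm {F G : CosetFace ρ} (h : F ≤ G) (h' : G ≤ F) : F = G :=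
  eq_of_le_of_idx_eq h (_root_.le_antisymm h.1 h'.1)

theorem idx_lt {F G : CosetFace ρ} (h : F ≤ G) (hne : F ≠ G) : F.idx < G.idx :=
  lt_of_le_of_ne h.1 fun H => hne (eq_of_le_of_idx_eq h H)

theorem mem_faceSubgroup {i : Fin n} {j : Fin (n + 2)} (h : (i : ℕ) + 1 ≠ j) :
    ρ i ∈ faceSubgroup ρ j := mem_closure_image_of_mem h

section Commute

variable (hc : ∀ i j : Fin n, (i : ℕ) + 2 ≤ j → Commute (ρ i) (ρ j))
include hc

/-- The elements of a face stabilizer are products of an element fixing all higher faces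
and an element fixing all lower faces. -/
theorem exists_mul_of_mem_faceSubgroup {j : Fin (n + 2)} {a : Γ} (ha : a ∈ faceSubgroup ρ j) :
    ∃ x ∈ Subgroup.closure (ρ '' {i | (i : ℕ) + 1 < j}),
      ∃ y ∈ Subgroup.closure (ρ '' {i | (j : ℕ) < i + 1}), a = x * y ∧ a = y * x := by
  have hcom : ∀ i ∈ {i : Fin n | (i : ℕ) + 1 < j}, ∀ k ∈ {i : Fin n | (j : ℕ) < i + 1},
      Commute (ρ i) (ρ k) := fun i hi k hk => hc i k (by simp at hi hk; omega)
  have hS : {i : Fin n | (i : ℕ) + 1 ≠ j} =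
      {i : Fin n | (i : ℕ) + 1 < j} ∪ {i : Fin n | (j : ℕ) < i + 1} := by
    ext i
    simp only [Set.mem_union, Set.mem_ofPred_eq]
    omega
  rw [faceSubgroup, hS] at ha
  obtain ⟨x, hx, y, hy, rfl⟩ := exists_mul_of_mem_closure_union hcom ha
  exact ⟨x, hx, y, hy, rfl, (commute_of_mem_closure_image_of_mem hcom hx hy).eq⟩

/-- A representative of a face can be changed to represent a given larger face as well, without
changing the smaller faces it represents. -/
theorem exists_extend {g : Γ} {j : Fin (n + 2)} {H : CosetFace ρ} (h : of ρ g j ≤ H) :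
    ∃ g', (∀ i ≤ j, of ρ g' i = of ρ g i) ∧ H = of ρ g' H.idx := by
  obtain ⟨hj, x, hx, hH⟩ := of_le_iff.1 h
  obtain ⟨a, ha, b, hb, -, hab⟩ := exists_mul_of_mem_faceSubgroup hc (of_eq_of_iff.1 hx)
  refine ⟨g * b, fun i hi => of_mul_eq ?_, ?_⟩
  · refine closure_image_mono ?_ hb
    intro k hk
    simp only [Set.mem_ofPred_eq] at hk ⊢
    have : (i : ℕ) ≤ j := hi
    omega
  · have hx' : x = g * b * a := by rw [mul_assoc, ← hab]; group
    conv_lhs => rw [hH]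
    rw [hx']
    refine of_mul_eq (closure_image_mono ?_ ha)
    intro k hk
    simp only [Set.mem_ofPred_eq] at hk ⊢
    have : (j : ℕ) ≤ H.idx := hj
    omega

theorem le_trans {F G H : CosetFace ρ} (h : F ≤ G) (h' : G ≤ H) : F ≤ H := by
  obtain ⟨hi, g, hF, hG⟩ := le_iff.1 h
  rw [hG] at h'
  obtain ⟨g', hg', hH⟩ := exists_extend hc h'
  exact le_iff.2 ⟨hi.trans h'.1, g', by rw [hg' _ hi]; exact hF, hH⟩

/-- All the faces of a chain have a common representative. -/
theorem exists_common {c : Set (CosetFace ρ)} (h : IsChain (· ≤ ·) c) :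
    ∃ g, ∀ F ∈ c, F = of ρ g F.idx := by
  have hle : ∀ F ∈ c, ∀ G ∈ c, F.idx ≤ G.idx → F ≤ G := by
    intro F hF G hG hi
    rcases eq_or_ne F G with rfl | hne
    · exact CosetFace.le_refl F
    rcases h hF hG hne with H | H
    · exact H
    · rw [eq_of_le_of_idx_eq H (_root_.le_antisymm H.1 hi)]
      exact CosetFace.le_refl F
  -- The representative is built upwards through the ranks, correcting it at each face of the chain
  -- without disturbing the lower ones.
  have key : ∀ k : ℕ, ∃ g, ∀ F ∈ c, (F.idx : ℕ) < k → F = of ρ g F.idx := by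
    intro k
    induction k with
    | zero => exact ⟨1, fun F _ h => absurd h (Nat.not_lt_zero _)⟩
    | succ k ih =>
      obtain ⟨g, hg⟩ := ih
      by_cases hk : ∃ F ∈ c, (F.idx : ℕ) = k
      · obtain ⟨F, hF, rfl⟩ := hk
        have huniq : ∀ G ∈ c, G.idx = F.idx → G = F := fun G hG hi =>
          eq_of_le_of_idx_eq (hle G hG F hF hi.le) hi
        by_cases hE : ∃ E ∈ c, E.idx < F.idx
        -- `E` is the face of the chain immediately below `F`; extending from `E` preserves all
        -- faces of index at most `E.idx`, hence everything already treated.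
        · obtain ⟨j, ⟨⟨E, hE, rfl⟩, hEF⟩, hmax⟩ :=
            (Set.toFinite {j | (∃ E ∈ c, E.idx = j) ∧ j < F.idx}).exists_maximal
              (let ⟨E, hE, hEF⟩ := hE; ⟨E.idx, ⟨E, hE, rfl⟩, hEF⟩)
          have hEF' : of ρ g E.idx ≤ F := by
            rw [← hg E hE hEF]
            exact hle E hE F hF hEF.le
          obtain ⟨g', hg', hF'⟩ := exists_extend hc hEF'
          refine ⟨g', fun G hG hGk => ?_⟩
          rcases Nat.lt_succ_iff_lt_or_eq.1 hGk with hlt | heq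
          · rw [hg' _ ?_]
            · exact hg G hG hlt
            · by_contra hcon
              exact hcon (hmax ⟨⟨G, hG, rfl⟩, hlt⟩ (not_le.1 hcon).le)
          · rw [huniq G hG (Fin.ext heq)]
            exact hF'
        · obtain ⟨g', hg'⟩ := F.exists_eq_of
          refine ⟨g', fun G hG hGk => ?_⟩
          rcases Nat.lt_succ_iff_lt_or_eq.1 hGk with hlt | heq
          · exact absurd ⟨G, hG, hlt⟩ hE
          · rw [huniq G hG (Fin.ext heq)]
            exact hg'
      · refine ⟨g, fun F hF hFk => hg F hF ?_⟩
        rcases Nat.lt_succ_iff_lt_or_eq.1 hFk with hlt | heq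
        · exact hlt
        · exact absurd ⟨F, hF, heq⟩ hk
  obtain ⟨g, hg⟩ := key (n + 2)
  exact ⟨g, fun F hF => hg F hF F.idx.2⟩

theorem exists_flag_eq (Φ : Flag (CosetFace ρ)) :
    ∃ g, (Φ : Set (CosetFace ρ)) = Set.range (of ρ g) := by
  obtain ⟨g, hg⟩ := exists_common hc Φ.Chain'
  refine ⟨g, Φ.max_chain' ?_ fun F hF => ⟨F.idx, (hg F hF).symm⟩⟩
  rintro _ ⟨i, rfl⟩ _ ⟨j, rfl⟩ -
  exact (le_total i j).imp of_le_of of_le_of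

/-- The flags of a section are the sets of faces in the section with a given representative. -/
theorem exists_section_flag_eq {F G : CosetFace ρ} (hFG : F ≤ G)
    (Φ : Flag {H : CosetFace ρ // F ≤ H ∧ H ≤ G}) :
    ∃ g, F = of ρ g F.idx ∧ G = of ρ g G.idx ∧ ∀ H, H ∈ Φ ↔ H.1 = of ρ g H.1.idx := by
  -- The ends of the section are adjoined so that the common representative also represents them.
  have hchain : IsChain (· ≤ ·) (insert F (insert G (Subtype.val '' Φ.carrier))) := by
    refine IsChain.insert (IsChain.insert ?_ ?_) ?_
    · rintro _ ⟨A, hA, rfl⟩ _ ⟨B, hB, rfl⟩ hne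
      exact Φ.Chain' hA hB fun h => hne (by rw [h])
    · rintro _ ⟨A, -, rfl⟩ -
      exact Or.inr A.2.2
    · rintro B hB -
      rcases hB with rfl | ⟨A, -, rfl⟩
      · exact Or.inl hFG
      · exact Or.inl A.2.1
  obtain ⟨g, hg⟩ := exists_common hc hchain
  refine ⟨g, hg F (by simp), hg G (by simp), ?_⟩
  have : Φ.carrier = {H | H.1 = of ρ g H.1.idx} := by
    refine Φ.max_chain' ?_ ?_
    · intro A hA B hB _
      change A.1 = _ at hA
      change B.1 = _ at hB
      change A.1 ≤ B.1 ∨ B.1 ≤ A.1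
      rw [hA, hB]
      exact (le_total _ _).imp of_le_of of_le_of
    · intro A hA
      exact hg A.1 (Or.inr (Or.inr ⟨A, hA, rfl⟩))
  intro H
  rw [← Flag.mem_coe_iff]
  change H ∈ Φ.carrier ↔ _
  rw [this]
  rfl

end Commute

/-- The flag of the section `G/F` represented by a common representative of `F` and `G`. -/
def sectionFlag {F G : CosetFace ρ} (g : Γ) (hF : F = of ρ g F.idx) (hG : G = of ρ g G.idx) :
    Flag {H : CosetFace ρ // F ≤ H ∧ H ≤ G} where
  carrier := {H | H.1 = of ρ g H.1.idx}
  Chain' := by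
    intro A hA B hB _
    change A.1 = _ at hA
    change B.1 = _ at hB
    change A.1 ≤ B.1 ∨ B.1 ≤ A.1
    rw [hA, hB]
    exact (le_total _ _).imp of_le_of of_le_of
  max_chain' := by
    intro s hs hsub
    refine Set.Subset.antisymm hsub fun H hH => ?_
    have hmem : F ≤ of ρ g H.1.idx ∧ of ρ g H.1.idx ≤ G := by
      constructor
      · exact le_iff.2 ⟨H.2.1.1, g, hF, rfl⟩
      · exact le_iff.2 ⟨H.2.2.1, g, rfl, hG⟩
    have h2 : (⟨of ρ g H.1.idx, hmem⟩ : {H : CosetFace ρ // F ≤ H ∧ H ≤ G}) ∈ s :=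
      hsub (by simp)
    rcases eq_or_ne H ⟨of ρ g H.1.idx, hmem⟩ with he | he
    · exact congrArg Subtype.val he
    · rcases hs hH h2 he with h3 | h3
      · exact eq_of_le_of_idx_eq h3 rfl
      · exact (eq_of_le_of_idx_eq h3 rfl).symm

@[simp] theorem mem_sectionFlag {F G : CosetFace ρ} {g : Γ} (hF : F = of ρ g F.idx)
    (hG : G = of ρ g G.idx) (H : {H : CosetFace ρ // F ≤ H ∧ H ≤ G}) :
    H ∈ (sectionFlag g hF hG : Set _) ↔ H.1 = of ρ g H.1.idx := Iff.rfl

/-- Left multiplication by `g`. -/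
def leftMul (g : Γ) : CosetFace ρ ≃o CosetFace ρ where
  toFun F := ⟨F.idx, g • F.coset⟩
  invFun F := ⟨F.idx, g⁻¹ • F.coset⟩
  left_inv F := by simp
  right_inv F := by simp
  map_rel_iff' := by
    have key : ∀ (g : Γ) (F G : CosetFace ρ), F ≤ G →
        (⟨F.idx, g • F.coset⟩ : CosetFace ρ) ≤ ⟨G.idx, g • G.coset⟩ := by
      rintro g F G ⟨hi, x, hF, hG⟩
      exact ⟨hi, g * x, by rw [← hF]; rfl, by rw [← hG]; rfl⟩
    intro F G
    refine ⟨fun h => ?_, key g F G⟩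
    simpa using key g⁻¹ _ _ h

@[simp] theorem leftMul_of (g x : Γ) (j : Fin (n + 2)) :
    leftMul g (of ρ x j) = of ρ (g * x) j := rfl

/-- The action of the group by left multiplication. -/
def leftMulHom (ρ : Fin n → Γ) : Γ →* (CosetFace ρ ≃o CosetFace ρ) where
  toFun := leftMul
  map_one' := by
    refine RelIso.ext fun F => ?_
    obtain ⟨x, hx⟩ := F.exists_eq_of
    rw [hx, leftMul_of, one_mul]
    rfl
  map_mul' g h := by
    refine RelIso.ext fun F => ?_
    obtain ⟨x, hx⟩ := F.exists_eq_of
    rw [hx, RelIso.mul_apply, leftMul_of, leftMul_of, leftMul_of, mul_assoc]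

@[simp] theorem leftMulHom_apply (g : Γ) : leftMulHom ρ g = leftMul g := rfl

theorem faceSubgroup_eq_top (hgen : Subgroup.closure (Set.range ρ) = ⊤) {j : Fin (n + 2)}
    (hj : ∀ i : Fin n, (i : ℕ) + 1 ≠ j) : faceSubgroup ρ j = ⊤ := by
  rw [faceSubgroup, ← hgen, ← Set.image_univ]
  congr 2
  ext i
  simp [hj i]

end CosetFace

/-! ### The polytope of a string C-group -/

namespace IsStringCGroup

open CosetFace

variable {n : ℕ} {Γ : Type*} [Group Γ] {ρ : Fin n → Γ} (hρ : IsStringCGroup ρ)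
include hρ

theorem mul_self (i : Fin n) : ρ i * ρ i = 1 := by
  rw [← pow_two, ← hρ.involution i, pow_orderOf_eq_one]

theorem ne_one (i : Fin n) : ρ i ≠ 1 := by
  intro h
  have := hρ.involution i
  rw [h, orderOf_one] at this
  omega

theorem notMem_faceSubgroup {i : Fin n} {j : Fin (n + 2)} (h : (i : ℕ) + 1 = j) :
    ρ i ∉ faceSubgroup ρ j := by
  intro hi
  have : ρ i ∈ Subgroup.closure (ρ '' {i}) ⊓ Subgroup.closure (ρ '' {i | (i : ℕ) + 1 ≠ j}) :=
    ⟨mem_closure_image_of_mem rfl, hi⟩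
  rw [hρ.intersection, (by ext k; simp; rintro rfl; exact h :
    ({i} ∩ {i | (i : ℕ) + 1 ≠ j} : Set (Fin n)) = ∅)] at this
  simp at this
  exact hρ.ne_one i this

theorem faceSubgroup_inf (j k : Fin (n + 2)) : faceSubgroup ρ j ⊓ faceSubgroup ρ k =
    Subgroup.closure (ρ '' {i | (i : ℕ) + 1 ≠ j ∧ (i : ℕ) + 1 ≠ k}) :=
  hρ.intersection _ _

theorem faceSubgroup_zero : faceSubgroup ρ 0 = ⊤ :=
  faceSubgroup_eq_top hρ.generate (by simp)

theorem faceSubgroup_last : faceSubgroup ρ (Fin.last _) = ⊤ :=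
  faceSubgroup_eq_top hρ.generate fun i => by simp; omega

theorem eq_of_idx_zero (F : CosetFace ρ) (h : F.idx = 0) (g : Γ) : F = of ρ g 0 := by
  obtain ⟨x, hx⟩ := F.exists_eq_of
  rw [hx, h, of_eq_of_iff, hρ.faceSubgroup_zero]
  trivial

theorem eq_of_idx_last (F : CosetFace ρ) (h : F.idx = Fin.last _) (g : Γ) :
    F = of ρ g (Fin.last _) := by
  obtain ⟨x, hx⟩ := F.exists_eq_of
  rw [hx, h, of_eq_of_iff, hρ.faceSubgroup_last]
  trivial

/-- Two incident faces whose ranks differ by two have exactly two faces between them. -/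
theorem between_iff {g : Γ} {i : Fin n} {j k l : Fin (n + 2)} (hj : (j : ℕ) = i)
    (hk : (k : ℕ) = i + 1) (hl : (l : ℕ) = i + 2) (H : CosetFace ρ) :
    (of ρ g j ≤ H ∧ H ≤ of ρ g l ∧ H.idx = k) ↔
      H = of ρ g k ∨ H = of ρ (g * ρ i) k := by
  constructor
  · rintro ⟨h1, h2, rfl⟩
    obtain ⟨x, hx, hxH⟩ := exists_extend hρ.commute h1
    rw [hxH] at h2
    obtain ⟨y, hy, hyl⟩ := exists_extend hρ.commute h2
    have hyH : H = of ρ y H.idx := by rw [hy _ (_root_.le_refl _)]; exact hxH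
    have hyj : of ρ g j = of ρ y j := by
      rw [hy j h1.1]; exact (hx _ (_root_.le_refl _)).symm
    have hmem : g⁻¹ * y ∈ faceSubgroup ρ j ⊓ faceSubgroup ρ l :=
      ⟨of_eq_of_iff.1 hyj, of_eq_of_iff.1 hyl⟩
    rw [hρ.faceSubgroup_inf] at hmem
    -- The generators left are `ρ i` and those not adjacent to it. The latter commute with `ρ i` and
    -- stabilize the base face of the middle rank, so only two cosets can occur.
    have key : ∀ z ∈ Subgroup.closure (ρ '' {a : Fin n | (a : ℕ) + 1 ≠ j ∧ (a : ℕ) + 1 ≠ l}),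
        of ρ z H.idx = of ρ 1 H.idx ∨ of ρ z H.idx = of ρ (ρ i) H.idx := by
      intro z hz
      refine closure_image_induction_left hρ.mul_self (p := fun z =>
        of ρ z H.idx = of ρ 1 H.idx ∨ of ρ z H.idx = of ρ (ρ i) H.idx) (Or.inl rfl) ?_ hz
      intro x _ a ha hp
      simp only [Set.mem_ofPred_eq] at ha
      have hp' := hp.imp (congrArg (leftMul (ρ a))) (congrArg (leftMul (ρ a)))
      simp only [leftMul_of, mul_one] at hp'
      by_cases hai : a = i
      · subst hai
        rw [hρ.mul_self] at hp'
        exact hp'.symm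
      · have ha' : (a : ℕ) ≠ i := fun h => hai (Fin.ext h)
        have hmem : ρ a ∈ faceSubgroup ρ H.idx := mem_faceSubgroup (by omega)
        have hcomm : ρ a * ρ i = ρ i * ρ a := by
          rcases lt_or_gt_of_ne ha' with h | h
          · exact hρ.commute a i (by omega)
          · exact (hρ.commute i a (by omega)).symm
        rw [hcomm, of_mul_eq hmem, ← one_mul (ρ a), of_mul_eq hmem] at hp'
        simpa using hp'
    have := (key _ hmem).imp (congrArg (leftMul g)) (congrArg (leftMul g))
    simpa [← hyH] using this
  · have hk1 : j ≤ k := by rw [Fin.le_def]; omega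
    have hk2 : k ≤ l := by rw [Fin.le_def]; omega
    rintro (rfl | rfl)
    · exact ⟨of_le_of hk1, of_le_of hk2, rfl⟩
    · refine ⟨?_, ?_, rfl⟩
      · rw [← of_mul_eq (mem_faceSubgroup (ρ := ρ) (i := i) (j := j) (by omega))]
        exact of_le_of hk1
      · rw [← of_mul_eq (g := g) (mem_faceSubgroup (ρ := ρ) (i := i) (j := l) (by omega))]
        exact of_le_of hk2

theorem of_mul_ne {g : Γ} {i : Fin n} {k : Fin (n + 2)} (hk : (k : ℕ) = i + 1) :
    of ρ g k ≠ of ρ (g * ρ i) k := by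
  rw [Ne, of_eq_of_iff]
  simpa using hρ.notMem_faceSubgroup hk.symm

/-- Right multiplication of the representative by `ρ i` changes only the face of index `i + 1`: the
flag moves to an adjacent one if that index lies strictly inside the section, and stays the same
otherwise. A word in the generators is thus a walk in the flag graph. -/
theorem reachable_sectionFlag {F G : CosetFace ρ} {g : Γ} (hF : F = of ρ g F.idx)
    (hG : G = of ρ g G.idx) {x : Γ} (hx : x ∈ faceSubgroup ρ F.idx ⊓ faceSubgroup ρ G.idx) :
    ∃ (hF' : F = of ρ (g * x) F.idx) (hG' : G = of ρ (g * x) G.idx),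
      (flagGraph _).Reachable (sectionFlag g hF hG) (sectionFlag (g * x) hF' hG') := by
  rw [hρ.faceSubgroup_inf] at hx
  refine closure_image_induction_right hρ.mul_self (p := fun x =>
    ∃ (hF' : F = of ρ (g * x) F.idx) (hG' : G = of ρ (g * x) G.idx),
      (flagGraph _).Reachable (sectionFlag g hF hG) (sectionFlag (g * x) hF' hG')) ?_ ?_ hx
  · simp only [mul_one]
    exact ⟨hF, hG, SimpleGraph.Reachable.refl _⟩
  · rintro x - i ⟨hi1, hi2⟩ ⟨hF', hG', hr⟩
    have hF'' : F = of ρ (g * (x * ρ i)) F.idx := by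
      rw [← mul_assoc, of_mul_eq (mem_faceSubgroup hi1)]; exact hF'
    have hG'' : G = of ρ (g * (x * ρ i)) G.idx := by
      rw [← mul_assoc, of_mul_eq (mem_faceSubgroup hi2)]; exact hG'
    refine ⟨hF'', hG'', ?_⟩
    have hsame : ∀ H : CosetFace ρ, (H.idx : ℕ) ≠ i + 1 →
        of ρ (g * (x * ρ i)) H.idx = of ρ (g * x) H.idx := fun H hH => by
      rw [← mul_assoc, of_mul_eq (mem_faceSubgroup hH.symm)]
    by_cases hin : (F.idx : ℕ) < i + 1 ∧ (i : ℕ) + 1 < G.idx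
    · refine hr.trans (SimpleGraph.Adj.reachable ?_)
      have hk : (i : ℕ) + 1 < n + 2 := by omega
      have hFk : F.idx ≤ ⟨i + 1, hk⟩ := by rw [Fin.le_def]; exact hin.1.le
      have hkG : ⟨i + 1, hk⟩ ≤ G.idx := by rw [Fin.le_def]; exact hin.2.le
      have hne := hρ.of_mul_ne (g := g * x) (i := i) (k := ⟨i + 1, hk⟩) rfl
      rw [mul_assoc] at hne
      have hdiff : ∀ (y z : Γ) (hFy : F = of ρ y F.idx) (hGy : G = of ρ y G.idx)
          (hFz : F = of ρ z F.idx) (hGz : G = of ρ z G.idx),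
          (∀ H : CosetFace ρ, (H.idx : ℕ) ≠ i + 1 → of ρ y H.idx = of ρ z H.idx) →
          of ρ y ⟨i + 1, hk⟩ ≠ of ρ z ⟨i + 1, hk⟩ →
          ((sectionFlag y hFy hGy : Set {H : CosetFace ρ // F ≤ H ∧ H ≤ G}) \
            (sectionFlag z hFz hGz : Set _)).ncard = 1 := by
        intro y z hFy hGy hFz hGz hs hn
        rw [Set.ncard_eq_one]
        refine ⟨⟨of ρ y ⟨i + 1, hk⟩, ?_, ?_⟩, ?_⟩
        · rw [hFy]; exact of_le_of hFk
        · rw [hGy]; exact of_le_of hkG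
        · ext H
          rw [Set.mem_sdiff, mem_sectionFlag, mem_sectionFlag, Set.mem_singleton_iff]
          constructor
          · rintro ⟨h1, h2⟩
            have hidx : H.1.idx = ⟨i + 1, hk⟩ := by
              apply Fin.ext
              by_contra hcon
              exact h2 (h1.trans (hs _ hcon))
            apply Subtype.ext
            rw [h1, hidx]
          · rintro rfl
            exact ⟨rfl, hn⟩
      exact ⟨hdiff _ _ _ _ _ _ (fun H hH => (hsame H hH).symm) hne,
        hdiff _ _ _ _ _ _ hsame hne.symm⟩
    · have : sectionFlag (g * x) hF' hG' = sectionFlag (g * (x * ρ i)) hF'' hG'' := by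
        apply SetLike.coe_injective
        ext H
        rw [mem_sectionFlag, mem_sectionFlag, hsame]
        intro hH
        apply hin
        have h1 : (F.idx : ℕ) ≤ H.1.idx := H.2.1.1
        have h2 : (H.1.idx : ℕ) ≤ G.idx := H.2.2.1
        omega
      rwa [← this]

theorem connected_section {F G : CosetFace ρ} (hFG : F ≤ G) :
    (flagGraph {H : CosetFace ρ // F ≤ H ∧ H ≤ G}).Connected := by
  obtain ⟨-, g, hF, hG⟩ := le_iff.1 hFG
  have key : ∀ Φ, (flagGraph {H : CosetFace ρ // F ≤ H ∧ H ≤ G}).Reachable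
      (sectionFlag g hF hG) Φ := by
    intro Φ
    obtain ⟨h, hF', hG', hΦ⟩ := exists_section_flag_eq hρ.commute hFG Φ
    have hx : g⁻¹ * h ∈ faceSubgroup ρ F.idx ⊓ faceSubgroup ρ G.idx :=
      ⟨of_eq_of_iff.1 (hF.symm.trans hF'), of_eq_of_iff.1 (hG.symm.trans hG')⟩
    obtain ⟨h1, h2, h3⟩ := hρ.reachable_sectionFlag hF hG hx
    convert h3
    apply SetLike.coe_injective
    ext H
    rw [mem_sectionFlag, mul_inv_cancel_left]
    exact hΦ H
  exact { preconnected := fun Φ Ψ => (key Φ).symm.trans (key Ψ), nonempty := ⟨sectionFlag g hF hG⟩ }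

/-- The coset geometry of a string C-group is a regular polytope. -/
theorem isRegularPolytope : IsRegularPolytope n (CosetFace ρ) CosetFace.rk where
  partialOrder :=
    { refl := CosetFace.le_refl
      trans := fun _ _ _ => CosetFace.le_trans hρ.commute
      antisymm := fun _ _ => CosetFace.le_antisymm }
  rk_strictMono F G h hne := by
    have : (F.idx : ℕ) < G.idx := idx_lt h hne
    simp only [CosetFace.rk]
    omega
  rk_range := by
    ext z
    simp only [Set.mem_range, Set.mem_Icc]
    constructor
    · rintro ⟨F, rfl⟩
      have := F.idx.2
      simp only [CosetFace.rk]
      omega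
    · rintro ⟨h1, h2⟩
      refine ⟨of ρ 1 ⟨(z + 1).toNat, by omega⟩, ?_⟩
      simp only [CosetFace.rk, of_idx]
      omega
  least := by
    refine ⟨of ρ 1 0, by simp [CosetFace.rk], fun G => ?_⟩
    obtain ⟨g, hg⟩ := G.exists_eq_of
    rw [← hρ.eq_of_idx_zero (of ρ g 0) rfl 1, hg]
    exact of_le_of (Fin.zero_le _)
  greatest := by
    refine ⟨of ρ 1 (Fin.last _), by simp [CosetFace.rk], fun G => ?_⟩
    obtain ⟨g, hg⟩ := G.exists_eq_of
    rw [← hρ.eq_of_idx_last (of ρ g (Fin.last _)) rfl 1, hg]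
    exact of_le_of (Fin.le_last _)
  flag_card Φ := by
    obtain ⟨g, hg⟩ := exists_flag_eq hρ.commute Φ
    rw [hg, ← Set.image_univ, Set.ncard_image_of_injective _ fun i j h => congrArg CosetFace.idx h,
      Set.ncard_univ, Nat.card_fin]
  diamond F G hFG hrk := by
    obtain ⟨-, g, hF, hG⟩ := le_iff.1 hFG
    simp only [CosetFace.rk] at hrk
    have hGlt := G.idx.2
    have hi : (F.idx : ℕ) < n := by omega
    have hk : (F.idx : ℕ) + 1 < n + 2 := by omega
    have hset : {H : CosetFace ρ | F ≤ H ∧ H ≤ G ∧ H.rk = F.rk + 1} =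
        {of ρ g ⟨F.idx + 1, hk⟩, of ρ (g * ρ ⟨F.idx, hi⟩) ⟨F.idx + 1, hk⟩} := by
      ext H
      have := hρ.between_iff (g := g) (i := ⟨F.idx, hi⟩) (j := F.idx) (k := ⟨F.idx + 1, hk⟩)
        (l := G.idx) rfl rfl (by simp; omega) H
      rw [← hF, ← hG] at this
      rw [Set.mem_insert_iff, Set.mem_singleton_iff, ← this, Set.mem_ofPred_eq]
      simp only [CosetFace.rk, Fin.ext_iff]
      constructor <;> rintro ⟨h1, h2, h3⟩ <;> exact ⟨h1, h2, by omega⟩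
    rw [hset, Set.ncard_pair]
    exact hρ.of_mul_ne rfl
  connected F G := hρ.connected_section
  flag_transitive Φ Ψ := by
    obtain ⟨g, hg⟩ := exists_flag_eq hρ.commute Φ
    obtain ⟨h, hh⟩ := exists_flag_eq hρ.commute Ψ
    refine ⟨leftMul (h * g⁻¹), ?_⟩
    rw [hg, hh, ← Set.range_comp]
    congr 1
    ext i : 1
    simp

/-- An element acting trivially stabilizes the whole base flag, and by the intersection property the
stabilizers of the base faces meet trivially. -/
theorem leftMulHom_injective : Function.Injective (leftMulHom ρ) := by
  rw [injective_iff_map_eq_one]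
  intro g hg
  have hfix : ∀ j, g ∈ faceSubgroup ρ j := by
    intro j
    have := DFunLike.congr_fun hg (of ρ 1 j)
    simp only [leftMulHom_apply, leftMul_of, mul_one] at this
    change _ = of ρ 1 j at this
    simpa using of_eq_of_iff.1 this.symm
  have key : ∀ k : ℕ, k ≤ n → g ∈ Subgroup.closure (ρ '' {i | k ≤ (i : ℕ)}) := by
    intro k
    induction k with
    | zero =>
      intro _
      have := hfix 0
      rw [faceSubgroup] at this
      convert this using 3
      simp
    | succ k ih =>
      intro hk
      have h1 : g ∈ _ ⊓ faceSubgroup ρ ⟨k + 1, by omega⟩ := ⟨ih (by omega), hfix _⟩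
      rw [faceSubgroup, hρ.intersection] at h1
      refine closure_image_mono ?_ h1
      rintro i ⟨h2, h3⟩
      simp only [Set.mem_ofPred_eq] at h2 h3 ⊢
      omega
  have := key n (_root_.le_refl _)
  rw [(by ext i; simp : {i : Fin n | n ≤ (i : ℕ)} = ∅)] at this
  simpa using this

/-- An automorphism sends the base flag to a flag with some representative `g`. It then agrees with
left multiplication by `g` on every flag: by the diamond condition, agreement on a flag propagates
to the adjacent flags. -/
theorem leftMulHom_surjective : Function.Surjective (leftMulHom ρ) := by
  intro f
  have hmono : StrictMono fun j => (f (of ρ 1 j)).idx := by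
    intro j k hjk
    refine idx_lt (f.map_rel_iff.2 (of_le_of hjk.le)) fun h => hjk.ne ?_
    exact congrArg CosetFace.idx (f.injective h)
  -- A strictly increasing self-map of a finite chain is the identity, so automorphisms preserve
  -- rank on the base flag.
  have hid : ∀ j, (f (of ρ 1 j)).idx = j := fun j =>
    _root_.le_antisymm hmono.apply_le hmono.le_apply
  have hchain : IsChain (· ≤ ·) (Set.range fun j => f (of ρ 1 j)) := by
    rintro _ ⟨i, rfl⟩ _ ⟨j, rfl⟩ -
    exact (le_total i j).imp (fun h => f.map_rel_iff.2 (of_le_of h))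
      (fun h => f.map_rel_iff.2 (of_le_of h))
  obtain ⟨g, hg⟩ := exists_common hρ.commute hchain
  have key : ∀ h ∈ Subgroup.closure (ρ '' Set.univ), ∀ j, f (of ρ h j) = of ρ (g * h) j := by
    intro h hh
    refine closure_image_induction_right hρ.mul_self
      (p := fun h => ∀ j, f (of ρ h j) = of ρ (g * h) j) ?_ ?_ hh
    · intro j
      have := hg _ ⟨j, rfl⟩
      simp only [hid] at this
      simpa using this
    · intro x _ i _ hx j
      by_cases hj : (i : ℕ) + 1 = j
      · have hlt := i.2
        let j₀ : Fin (n + 2) := ⟨i, by omega⟩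
        let j₂ : Fin (n + 2) := ⟨i + 2, by omega⟩
        have hb := (hρ.between_iff (g := x) (i := i) (j := j₀) (k := j) (l := j₂) rfl hj.symm rfl
          (of ρ (x * ρ i) j)).2 (Or.inr rfl)
        have h1 : of ρ (g * x) j₀ ≤ f (of ρ (x * ρ i) j) := by
          rw [← hx]; exact f.map_rel_iff.2 hb.1
        have h2 : f (of ρ (x * ρ i) j) ≤ of ρ (g * x) j₂ := by
          rw [← hx]; exact f.map_rel_iff.2 hb.2.1
        have h3 : of ρ (g * x) j₀ ≠ f (of ρ (x * ρ i) j) := by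
          rw [← hx]
          intro h
          have := congrArg (fun F => (CosetFace.idx F : ℕ)) (f.injective h)
          simp [j₀] at this
          omega
        have h4 : f (of ρ (x * ρ i) j) ≠ of ρ (g * x) j₂ := by
          rw [← hx]
          intro h
          have := congrArg (fun F => (CosetFace.idx F : ℕ)) (f.injective h)
          simp [j₂] at this
          omega
        have h5 : (f (of ρ (x * ρ i) j)).idx = j := by
          have l1 : (i : ℕ) < (f (of ρ (x * ρ i) j)).idx := idx_lt h1 h3
          have l2 : ((f (of ρ (x * ρ i) j)).idx : ℕ) < i + 2 := idx_lt h2 h4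
          apply Fin.ext
          omega
        rcases (hρ.between_iff (g := g * x) (i := i) (j := j₀) (k := j) (l := j₂) rfl hj.symm rfl
          _).1 ⟨h1, h2, h5⟩ with h | h
        · rw [← hx] at h
          exact absurd (f.injective h).symm (hρ.of_mul_ne hj.symm)
        · rw [h, mul_assoc]
      · rw [of_mul_eq (mem_faceSubgroup hj), ← mul_assoc, of_mul_eq (mem_faceSubgroup hj), hx]
  refine ⟨g, ?_⟩
  refine RelIso.ext fun F => ?_
  obtain ⟨x, hx⟩ := F.exists_eq_of
  rw [hx, leftMulHom_apply, leftMul_of, key]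
  rw [Set.image_univ, hρ.generate]
  trivial

/-- The group of a string C-group is the automorphism group of its polytope. -/
noncomputable def automorphismEquiv : Γ ≃* (CosetFace ρ ≃o CosetFace ρ) :=
  MulEquiv.ofBijective (leftMulHom ρ) ⟨hρ.leftMulHom_injective, hρ.leftMulHom_surjective⟩

end IsStringCGroup

/-! ### Facets and vertex-figures -/

namespace CosetFace

variable {n : ℕ} {Γ : Type*} [Group Γ] {ρ : Fin n → Γ}

/-- All lower intervals below faces of the same rank are isomorphic. -/
theorem nonempty_lower_iso (F : CosetFace ρ) :
    Nonempty ({H // H ≤ F} ≃o {H // H ≤ of ρ 1 F.idx}) := by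
  obtain ⟨g, hg⟩ := F.exists_eq_of
  refine ⟨(leftMul g⁻¹).toEquiv.subtypeEquiv fun H => ?_, fun {H K} => (leftMul g⁻¹).map_rel_iff⟩
  have hF : leftMul g⁻¹ F = of ρ 1 F.idx := by
    conv_lhs => rw [hg]
    simp
  rw [← hF]
  exact ((leftMul (ρ := ρ) g⁻¹).map_rel_iff (a := H) (b := F)).symm

/-- All upper intervals above faces of the same rank are isomorphic. -/
theorem nonempty_upper_iso (F : CosetFace ρ) :
    Nonempty ({H // F ≤ H} ≃o {H // of ρ 1 F.idx ≤ H}) := by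
  obtain ⟨g, hg⟩ := F.exists_eq_of
  refine ⟨(leftMul g⁻¹).toEquiv.subtypeEquiv fun H => ?_, fun {H K} => (leftMul g⁻¹).map_rel_iff⟩
  have hF : leftMul g⁻¹ F = of ρ 1 F.idx := by
    conv_lhs => rw [hg]
    simp
  rw [← hF]
  exact ((leftMul (ρ := ρ) g⁻¹).map_rel_iff (a := F) (b := H)).symm

end CosetFace

/-! ### A criterion for the intersection property -/

section Intersection

variable {n : ℕ} {Γ : Type*} [Group Γ] {ρ : Fin n → Γ}

/-- A set of generators missing `p` splits into commuting parts below and above `p`. An element of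
both groups can thus be written `x * y`, split at `p`, and `z * w`, split at `q`. Comparing the two
factorizations puts `z⁻¹ * x = w * y⁻¹` in the group of the open interval `(p,q)`; splitting `z` and
`y` once more separates the element into pieces below `p`, between `p` and `q`, and above `q`, each
generated by `I ∩ J`. -/
theorem inf_le_of_consecutive_aux (hc : ∀ i j : Fin n, (i : ℕ) + 2 ≤ j → Commute (ρ i) (ρ j))
    {a b : ℕ}
    (hlow : ∀ I J : Set (Fin n), (∀ i ∈ I, a ≤ (i : ℕ) ∧ (i : ℕ) < b) →
      (∀ i ∈ J, a ≤ (i : ℕ) ∧ (i : ℕ) < b) →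
      Subgroup.closure (ρ '' I) ⊓ Subgroup.closure (ρ '' J) ≤ Subgroup.closure (ρ '' (I ∩ J)))
    (hup : ∀ I J : Set (Fin n), (∀ i ∈ I, a + 1 ≤ (i : ℕ) ∧ (i : ℕ) < b + 1) →
      (∀ i ∈ J, a + 1 ≤ (i : ℕ) ∧ (i : ℕ) < b + 1) →
      Subgroup.closure (ρ '' I) ⊓ Subgroup.closure (ρ '' J) ≤ Subgroup.closure (ρ '' (I ∩ J)))
    (hmid : Subgroup.closure (ρ '' {i | a ≤ (i : ℕ) ∧ (i : ℕ) < b}) ⊓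
      Subgroup.closure (ρ '' {i | a < (i : ℕ) ∧ (i : ℕ) ≤ b}) ≤
      Subgroup.closure (ρ '' {i | a < (i : ℕ) ∧ (i : ℕ) < b}))
    {I J : Set (Fin n)} (hI : ∀ i ∈ I, a ≤ (i : ℕ) ∧ (i : ℕ) ≤ b)
    (hJ : ∀ i ∈ J, a ≤ (i : ℕ) ∧ (i : ℕ) ≤ b) {p q : ℕ} (hap : a ≤ p) (hpq : p ≤ q) (hqb : q ≤ b)
    (hpI : ∀ i ∈ I, (i : ℕ) ≠ p) (hqJ : ∀ i ∈ J, (i : ℕ) ≠ q) :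
    Subgroup.closure (ρ '' I) ⊓ Subgroup.closure (ρ '' J) ≤ Subgroup.closure (ρ '' (I ∩ J)) := by
  have split : ∀ (K : Set (Fin n)) (r : ℕ), (∀ i ∈ K, (i : ℕ) ≠ r) →
      ∀ g ∈ Subgroup.closure (ρ '' K), ∃ x ∈ Subgroup.closure (ρ '' (K ∩ {i | (i : ℕ) < r})),
        ∃ y ∈ Subgroup.closure (ρ '' (K ∩ {i | r < (i : ℕ)})), g = x * y := by
    intro K r hK g hg
    refine exists_mul_of_mem_closure_union ?_ ?_
    · rintro i ⟨-, hi⟩ j ⟨-, hj⟩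
      simp only [Set.mem_ofPred_eq] at hi hj
      exact hc i j (by omega)
    · convert hg using 3
      ext i
      simp only [Set.mem_union, Set.mem_inter_iff, Set.mem_ofPred_eq]
      constructor
      · tauto
      · intro hi
        have := hK i hi
        rcases lt_or_gt_of_ne this with h | h <;> tauto
  -- elements generated both below `q` and above `p` are generated strictly between
  have between : ∀ x ∈ Subgroup.closure (ρ '' {i | a ≤ (i : ℕ) ∧ (i : ℕ) < q}),
      x ∈ Subgroup.closure (ρ '' {i | p < (i : ℕ) ∧ (i : ℕ) ≤ b}) →
      x ∈ Subgroup.closure (ρ '' {i | p < (i : ℕ) ∧ (i : ℕ) < q}) := by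
    intro x hx hx'
    have h1 : x ∈ Subgroup.closure (ρ '' {i | a < (i : ℕ) ∧ (i : ℕ) < b}) :=
      hmid ⟨closure_image_mono (by intro i; simp only [Set.mem_ofPred_eq]; omega) hx,
        closure_image_mono (by intro i; simp only [Set.mem_ofPred_eq]; omega) hx'⟩
    have h2 := hlow {i | a ≤ (i : ℕ) ∧ (i : ℕ) < q} {i | a < (i : ℕ) ∧ (i : ℕ) < b}
      (by intro i; simp only [Set.mem_ofPred_eq]; omega)
      (by intro i; simp only [Set.mem_ofPred_eq]; omega) ⟨hx, h1⟩
    have h3 := hup ({i | a ≤ (i : ℕ) ∧ (i : ℕ) < q} ∩ {i | a < (i : ℕ) ∧ (i : ℕ) < b})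
      {i | p < (i : ℕ) ∧ (i : ℕ) ≤ b}
      (by intro i; simp only [Set.mem_inter_iff, Set.mem_ofPred_eq]; omega)
      (by intro i; simp only [Set.mem_ofPred_eq]; omega) ⟨h2, hx'⟩
    exact closure_image_mono (by
      intro i; simp only [Set.mem_inter_iff, Set.mem_ofPred_eq]; omega) h3
  have trivial_inter : ∀ x ∈ Subgroup.closure (ρ '' {i | a ≤ (i : ℕ) ∧ (i : ℕ) < p}),
      x ∈ Subgroup.closure (ρ '' {i | p < (i : ℕ) ∧ (i : ℕ) ≤ b}) → x = 1 := by
    intro x hx hx'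
    have h1 := between x (closure_image_mono
      (by intro i; simp only [Set.mem_ofPred_eq]; omega) hx) hx'
    have h2 := hlow {i | a ≤ (i : ℕ) ∧ (i : ℕ) < p} {i | p < (i : ℕ) ∧ (i : ℕ) < q}
      (by intro i; simp only [Set.mem_ofPred_eq]; omega)
      (by intro i; simp only [Set.mem_ofPred_eq]; omega) ⟨hx, h1⟩
    rw [(by ext i; simp only [Set.mem_inter_iff, Set.mem_ofPred_eq, Set.mem_empty_iff_false, iff_false]; omega :
      ({i : Fin n | a ≤ (i : ℕ) ∧ (i : ℕ) < p} ∩ {i | p < (i : ℕ) ∧ (i : ℕ) < q}) = ∅)] at h2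
    simpa using h2
  rintro g ⟨hgI, hgJ⟩
  obtain ⟨x, hx, y, hy, hxy⟩ := split I p hpI g hgI
  obtain ⟨z, hz, w, hw, hzw⟩ := split J q hqJ g hgJ
  have hX : {i : Fin n | a ≤ (i : ℕ) ∧ (i : ℕ) < p} ⊆ {i | a ≤ (i : ℕ) ∧ (i : ℕ) < q} := by
    intro i; simp only [Set.mem_ofPred_eq]; omega
  have hIlow : I ∩ {i | (i : ℕ) < p} ⊆ {i | a ≤ (i : ℕ) ∧ (i : ℕ) < p} :=
    fun i hi => ⟨(hI i hi.1).1, hi.2⟩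
  have hIup : I ∩ {i | p < (i : ℕ)} ⊆ {i | p < (i : ℕ) ∧ (i : ℕ) ≤ b} :=
    fun i hi => ⟨hi.2, (hI i hi.1).2⟩
  have hJlow : J ∩ {i | (i : ℕ) < q} ⊆ {i | a ≤ (i : ℕ) ∧ (i : ℕ) < q} :=
    fun i hi => ⟨(hJ i hi.1).1, hi.2⟩
  have hJup : J ∩ {i | q < (i : ℕ)} ⊆ {i | p < (i : ℕ) ∧ (i : ℕ) ≤ b} :=
    fun i hi => ⟨lt_of_le_of_lt hpq hi.2, (hJ i hi.1).2⟩
  have hm : z⁻¹ * x = w * y⁻¹ := by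
    rw [inv_mul_eq_iff_eq_mul, ← mul_assoc, eq_mul_inv_iff_mul_eq, ← hxy, ← hzw]
  have hmem : z⁻¹ * x ∈ Subgroup.closure (ρ '' {i | p < (i : ℕ) ∧ (i : ℕ) < q}) := by
    refine between _ (mul_mem (inv_mem (closure_image_mono hJlow hz))
      (closure_image_mono (hIlow.trans hX) hx)) ?_
    rw [hm]
    exact mul_mem (closure_image_mono hJup hw) (inv_mem (closure_image_mono hIup hy))
  -- the components of `g` split further
  have hz' : z ∈ Subgroup.closure (ρ '' ((J ∩ {i | (i : ℕ) < q}) ∩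
      ((I ∩ {i | (i : ℕ) < p}) ∪ {i | p < (i : ℕ) ∧ (i : ℕ) < q}))) := by
    refine hlow _ _ ?_ ?_ (Subgroup.mem_inf.2 ⟨hz, ?_⟩)
    · intro i hi; have := hJlow hi; simp only [Set.mem_ofPred_eq] at this; omega
    · rintro i (hi | hi)
      · have := hIlow hi; simp only [Set.mem_ofPred_eq] at this; omega
      · simp only [Set.mem_ofPred_eq] at hi; omega
    · have : z = x * (z⁻¹ * x)⁻¹ := by group
      rw [this]
      exact mul_mem (closure_image_mono Set.subset_union_left hx)
        (inv_mem (closure_image_mono Set.subset_union_right hmem))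
  have hy' : y ∈ Subgroup.closure (ρ '' ((I ∩ {i | p < (i : ℕ)}) ∩
      ((J ∩ {i | q < (i : ℕ)}) ∪ {i | p < (i : ℕ) ∧ (i : ℕ) < q}))) := by
    refine hup _ _ ?_ ?_ (Subgroup.mem_inf.2 ⟨hy, ?_⟩)
    · intro i hi; have := hIup hi; simp only [Set.mem_ofPred_eq] at this; omega
    · rintro i (hi | hi)
      · have := hJup hi; simp only [Set.mem_ofPred_eq] at this; omega
      · simp only [Set.mem_ofPred_eq] at hi; omega
    · have : y = (z⁻¹ * x)⁻¹ * w := by rw [hm]; group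
      rw [this]
      exact mul_mem (inv_mem (closure_image_mono Set.subset_union_right hmem))
        (closure_image_mono Set.subset_union_left hw)
  obtain ⟨z₁, hz₁, z₂, hz₂, rfl⟩ := split _ p (by
    rintro i ⟨-, hi | hi⟩
    · exact hpI i hi.1
    · exact hi.1.ne') z hz'
  obtain ⟨y₁, hy₁, y₂, hy₂, rfl⟩ := split _ q (by
    rintro i ⟨-, hi | hi⟩
    · exact hqJ i hi.1
    · exact hi.2.ne) y hy'
  have hz₁I : z₁ ∈ Subgroup.closure (ρ '' ((I ∩ J) ∩ {i | (i : ℕ) < p})) := by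
    refine closure_image_mono ?_ hz₁
    rintro i ⟨⟨h1, h2 | h2⟩, h3⟩
    · exact ⟨⟨h2.1, h1.1⟩, h3⟩
    · simp only [Set.mem_ofPred_eq] at h2 h3; omega
  have hz₂J : z₂ ∈ Subgroup.closure (ρ '' (J ∩ {i | p < (i : ℕ) ∧ (i : ℕ) < q})) := by
    refine closure_image_mono ?_ hz₂
    rintro i ⟨⟨h1, h2 | h2⟩, h3⟩
    · have := h2.2; simp only [Set.mem_ofPred_eq] at this h3; omega
    · exact ⟨h1.1, h2⟩
  have hy₂I : y₂ ∈ Subgroup.closure (ρ '' ((I ∩ J) ∩ {i | q < (i : ℕ)})) := by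
    refine closure_image_mono ?_ hy₂
    rintro i ⟨⟨h1, h2 | h2⟩, h3⟩
    · exact ⟨⟨h1.1, h2.1⟩, h3⟩
    · simp only [Set.mem_ofPred_eq] at h2 h3; omega
  have hy₁I : y₁ ∈ Subgroup.closure (ρ '' (I ∩ {i | p < (i : ℕ) ∧ (i : ℕ) < q})) := by
    refine closure_image_mono ?_ hy₁
    rintro i ⟨⟨h1, h2 | h2⟩, h3⟩
    · have := h2.2; simp only [Set.mem_ofPred_eq] at this h3; omega
    · exact ⟨h1.1, h2⟩
  -- The element is generated below `p` and also above `p`, so it is trivial; `hqtriv` is the mirror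
  -- argument at `q`.
  have hx1 : z₁⁻¹ * x = 1 := by
    refine trivial_inter _ (mul_mem (inv_mem (closure_image_mono ?_ hz₁I))
      (closure_image_mono hIlow hx)) ?_
    · exact fun i hi => ⟨(hI i hi.1.1).1, hi.2⟩
    · have : z₁⁻¹ * x = z₂ * ((z₁ * z₂)⁻¹ * x) := by group
      rw [this]
      refine mul_mem (closure_image_mono ?_ hz₂J) (closure_image_mono ?_ hmem)
      · intro i hi; have := hi.2; simp only [Set.mem_ofPred_eq] at this ⊢; omega
      · intro i hi; simp only [Set.mem_ofPred_eq] at hi ⊢; omega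
  have hxz : x = z₁ := by rw [inv_mul_eq_one] at hx1; exact hx1.symm
  have hw1 : w * y₂⁻¹ = z₂⁻¹ * y₁ := by
    have : z₁ * z₂ * w = z₁ * (y₁ * y₂) := by rw [← hxz, ← hxy, hzw, hxz]
    rw [mul_assoc, mul_right_inj] at this
    rw [mul_inv_eq_iff_eq_mul, mul_assoc, eq_inv_mul_iff_mul_eq, this]
  have hqtriv : w * y₂⁻¹ = 1 := by
    have h1 : w * y₂⁻¹ ∈ Subgroup.closure (ρ '' {i | p < (i : ℕ) ∧ (i : ℕ) < q}) := by
      rw [hw1]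
      exact mul_mem (inv_mem (closure_image_mono Set.inter_subset_right hz₂J))
        (closure_image_mono Set.inter_subset_right hy₁I)
    have h2 : w * y₂⁻¹ ∈ Subgroup.closure (ρ '' {i | q < (i : ℕ) ∧ (i : ℕ) ≤ b}) := by
      refine mul_mem (closure_image_mono ?_ hw) (inv_mem (closure_image_mono ?_ hy₂I))
      · exact fun i hi => ⟨hi.2, (hJ i hi.1).2⟩
      · exact fun i hi => ⟨hi.2, (hI i hi.1.1).2⟩
    have h3 := hup _ _ (by intro i; simp only [Set.mem_ofPred_eq]; omega)
      (by intro i; simp only [Set.mem_ofPred_eq]; omega) ⟨h1, h2⟩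
    rw [(by ext i; simp only [Set.mem_inter_iff, Set.mem_ofPred_eq, Set.mem_empty_iff_false, iff_false]; omega :
      ({i : Fin n | p < (i : ℕ) ∧ (i : ℕ) < q} ∩ {i | q < (i : ℕ) ∧ (i : ℕ) ≤ b}) = ∅)] at h3
    simpa using h3
  have hyz : z₂ = y₁ := by rwa [hw1, inv_mul_eq_one] at hqtriv
  have hmidmem : y₁ ∈ Subgroup.closure (ρ '' (I ∩ J)) := by
    have h1 := hlow _ _ (by intro i hi; have := hi.2; simp only [Set.mem_ofPred_eq] at this; omega)
      (by intro i hi; have := hi.2; simp only [Set.mem_ofPred_eq] at this; omega) ⟨hy₁I, hyz ▸ hz₂J⟩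
    refine closure_image_mono ?_ h1
    exact fun i hi => ⟨hi.1.1, hi.2.1⟩
  rw [hxy, hxz]
  exact mul_mem (closure_image_mono Set.inter_subset_left hz₁I)
    (mul_mem hmidmem (closure_image_mono Set.inter_subset_left hy₂I))

/-- The intersection property of a string group follows from its special case for pairs of
intervals of generators shifted by one. -/
theorem closure_inf_closure_of_intervals
    (hc : ∀ i j : Fin n, (i : ℕ) + 2 ≤ j → Commute (ρ i) (ρ j))
    (h : ∀ k l : Fin n, k < l →
      Subgroup.closure (ρ '' Set.Ico k l) ⊓ Subgroup.closure (ρ '' Set.Ioc k l) ≤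
        Subgroup.closure (ρ '' Set.Ioo k l)) (I J : Set (Fin n)) :
    Subgroup.closure (ρ '' I) ⊓ Subgroup.closure (ρ '' J) = Subgroup.closure (ρ '' (I ∩ J)) := by
  refine le_antisymm ?_ (le_inf (closure_image_mono Set.inter_subset_left)
    (closure_image_mono Set.inter_subset_right))
  -- Induction on the length `m` of an interval `[a,b)` containing both sets. If one of them is the
  -- whole interval there is nothing to prove; otherwise each misses an index.
  have key : ∀ m a b : ℕ, b ≤ n → b = a + m → ∀ I J : Set (Fin n),
      (∀ i ∈ I, a ≤ (i : ℕ) ∧ (i : ℕ) < b) → (∀ i ∈ J, a ≤ (i : ℕ) ∧ (i : ℕ) < b) →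
      Subgroup.closure (ρ '' I) ⊓ Subgroup.closure (ρ '' J) ≤
        Subgroup.closure (ρ '' (I ∩ J)) := by
    intro m
    induction m with
    | zero =>
      intro a b _ hab I J hI _ x hx
      have : I = ∅ := by
        ext i
        simp only [Set.mem_empty_iff_false, iff_false]
        intro hi
        have := hI i hi
        omega
      rw [this, Set.empty_inter]
      rw [this] at hx
      exact hx.1
    | succ m ih =>
      intro a b hbn hab I J hI hJ
      by_cases hIall : ∀ r, a ≤ r → r < b → ∃ i ∈ I, (i : ℕ) = r
      · have hJI : J ⊆ I := fun j hj => by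
          obtain ⟨i, hi, hij⟩ := hIall j (hJ j hj).1 (hJ j hj).2
          rwa [← Fin.ext hij]
        rw [Set.inter_eq_right.2 hJI]
        exact inf_le_right
      by_cases hJall : ∀ r, a ≤ r → r < b → ∃ i ∈ J, (i : ℕ) = r
      · have hIJ : I ⊆ J := fun j hj => by
          obtain ⟨i, hi, hij⟩ := hJall j (hI j hj).1 (hI j hj).2
          rwa [← Fin.ext hij]
        rw [Set.inter_eq_left.2 hIJ]
        exact inf_le_left
      push Not at hIall hJall
      obtain ⟨p, hp1, hp2, hp⟩ := hIall
      obtain ⟨q, hq1, hq2, hq⟩ := hJall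
      obtain ⟨c, rfl⟩ : ∃ c, b = c + 1 := ⟨a + m, by omega⟩
      have hmid : Subgroup.closure (ρ '' {i | a ≤ (i : ℕ) ∧ (i : ℕ) < c}) ⊓
          Subgroup.closure (ρ '' {i | a < (i : ℕ) ∧ (i : ℕ) ≤ c}) ≤
          Subgroup.closure (ρ '' {i | a < (i : ℕ) ∧ (i : ℕ) < c}) := by
        rcases Nat.eq_zero_or_pos m with rfl | hm
        · intro x hx
          have h1 := hx.1
          rw [(by ext i; simp only [Set.mem_ofPred_eq, Set.mem_empty_iff_false, iff_false]; omega :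
            {i : Fin n | a ≤ (i : ℕ) ∧ (i : ℕ) < c} = ∅)] at h1
          exact closure_image_mono (Set.empty_subset _) h1
        · exact h ⟨a, by omega⟩ ⟨c, by omega⟩ (by rw [Fin.lt_def]; simp only; omega)
      have hlow := ih a c (by omega) (by omega)
      have hup := ih (a + 1) (c + 1) hbn (by omega)
      rcases le_total p q with hpq | hqp
      · exact inf_le_of_consecutive_aux hc hlow hup hmid
          (fun i hi => ⟨(hI i hi).1, Nat.lt_succ_iff.1 (hI i hi).2⟩)
          (fun i hi => ⟨(hJ i hi).1, Nat.lt_succ_iff.1 (hJ i hi).2⟩) hp1 hpq (by omega) hp hq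
      · rw [inf_comm, Set.inter_comm]
        exact inf_le_of_consecutive_aux hc hlow hup hmid
          (fun i hi => ⟨(hJ i hi).1, Nat.lt_succ_iff.1 (hJ i hi).2⟩)
          (fun i hi => ⟨(hI i hi).1, Nat.lt_succ_iff.1 (hI i hi).2⟩) hq1 hqp (by omega) hq hp
  exact key n 0 n le_rfl (by simp) I J (fun i _ => ⟨Nat.zero_le _, i.2⟩)
    (fun i _ => ⟨Nat.zero_le _, i.2⟩)

end Intersection

/-! ### Vertex-figures -/

section VertexFigure

open CosetFace

variable {n : ℕ} {Γ Γ' : Type*} [Group Γ] [Group Γ'] {ρ : Fin (n + 1) → Γ} {ρ' : Fin n → Γ'}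

theorem map_closure_image {ι κ : Type*} {σ : ι → Γ} {σ' : κ → Γ'} {φ : Γ' →* Γ} {f : κ → ι}
    (h : ∀ k, φ (σ' k) = σ (f k)) (S : Set κ) :
    (Subgroup.closure (σ' '' S)).map φ = Subgroup.closure (σ '' (f '' S)) := by
  rw [MonoidHom.map_closure, Set.image_image, Set.image_image]
  simp only [h]

/-- The vertex-figures of the polytope of a string C-group, described by an abstract copy of the
group of the base vertex. -/
theorem IsStringCGroup.nonempty_vertexFigure_iso (hρ : IsStringCGroup ρ)
    (hgen : Subgroup.closure (Set.range ρ') = ⊤) {φ : Γ' →* Γ} (hinj : Function.Injective φ)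
    (hφ : ∀ i, φ (ρ' i) = ρ i.succ) (F : CosetFace ρ) (hF : F.rk = 0) :
    Nonempty ({H // F ≤ H} ≃o CosetFace ρ') := by
  have hF1 : F.idx = 1 := by
    simp only [CosetFace.rk] at hF
    apply Fin.ext
    simp
    omega
  obtain ⟨e⟩ := F.nonempty_upper_iso
  rw [hF1] at e
  have hrange : ∀ g, g ∈ faceSubgroup ρ 1 ↔ ∃ x, φ x = g := by
    intro g
    have := map_closure_image hφ Set.univ
    rw [Set.image_univ, hgen, Set.image_univ] at this
    rw [← MonoidHom.mem_range, MonoidHom.range_eq_map, this, faceSubgroup]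
    have hS : {i : Fin (n + 1) | (i : ℕ) + 1 ≠ (1 : Fin (n + 1 + 2))} = Set.range Fin.succ := by
      ext i
      rw [Fin.range_succ, Set.mem_ofPred_eq, Set.mem_compl_singleton_iff, Ne, Ne, Fin.ext_iff,
        Fin.val_one, Fin.val_zero]
      omega
    rw [hS]
  -- The intersection property enters here: stabilizing the base vertex and another base face means
  -- being generated by the reflections common to both stabilizers. Injectivity of `φ` then pulls
  -- this back to `Γ'`, with indices shifted by one.
  have hsub : ∀ (j : Fin (n + 2)) (x : Γ'),
      φ x ∈ faceSubgroup ρ j.succ ↔ x ∈ faceSubgroup ρ' j := by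
    intro j x
    have h1 : φ x ∈ faceSubgroup ρ j.succ ↔ φ x ∈ faceSubgroup ρ 1 ⊓ faceSubgroup ρ j.succ :=
      ⟨fun h => ⟨(hrange _).2 ⟨x, rfl⟩, h⟩, fun h => h.2⟩
    have hS : {i : Fin (n + 1) | (i : ℕ) + 1 ≠ (1 : Fin (n + 1 + 2)) ∧
        (i : ℕ) + 1 ≠ (j.succ : Fin (n + 1 + 2))} = Fin.succ '' {i : Fin n | (i : ℕ) + 1 ≠ j} := by
      ext i
      simp only [Set.mem_ofPred_eq, Set.mem_image]
      constructor
      · rintro ⟨hi, hi'⟩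
        have hi0 : i ≠ 0 := fun h => hi (by rw [h, Fin.val_zero, Fin.val_one])
        have hpos : (i : ℕ) ≠ 0 := fun h => hi0 (Fin.ext h)
        refine ⟨i.pred hi0, ?_, Fin.succ_pred _ _⟩
        rw [Fin.val_succ] at hi'
        rw [Fin.val_pred]
        omega
      · rintro ⟨i, hi, rfl⟩
        constructor
        · rw [Fin.val_succ, Fin.val_one]
          omega
        · rw [Fin.val_succ, Fin.val_succ]
          omega
    rw [h1, hρ.faceSubgroup_inf, hS, ← map_closure_image hφ]
    constructor
    · rintro ⟨y, hy, hyx⟩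
      rwa [← hinj hyx]
    · exact fun h => ⟨x, h, rfl⟩
  have hbase : ∀ (x : Γ') (j : Fin (n + 2)), of ρ 1 1 ≤ of ρ (φ x) j.succ := by
    intro x j
    rw [← of_mul_eq (g := 1) ((hrange _).2 ⟨x, rfl⟩), one_mul]
    refine of_le_of ?_
    rw [Fin.le_def]
    simp
  have hofsucc : ∀ (x y : Γ') (j : Fin (n + 2)),
      of ρ (φ x) j.succ = of ρ (φ y) j.succ ↔ of ρ' x j = of ρ' y j := by
    intro x y j
    rw [of_eq_of_iff, of_eq_of_iff, ← map_inv, ← map_mul, hsub]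
  choose r hr using fun K : CosetFace ρ' => K.exists_eq_of
  let f : CosetFace ρ' → {H // of ρ 1 1 ≤ H} := fun K => ⟨of ρ (φ (r K)) K.idx.succ, hbase _ _⟩
  have hf : ∀ x j, (f (of ρ' x j)).1 = of ρ (φ x) j.succ := by
    intro x j
    exact (hofsucc _ _ j).2 (hr (of ρ' x j)).symm
  have hle : ∀ K L, K ≤ L ↔ f K ≤ f L := by
    intro K L
    constructor
    · intro h
      obtain ⟨hi, x, hK, hL⟩ := le_iff.1 h
      change (f K).1 ≤ (f L).1
      rw [hK, hL, hf, hf]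
      exact of_le_of (Fin.succ_le_succ_iff.2 hi)
    · intro h
      have h1 := (f K).2
      obtain ⟨g, hg, hg'⟩ := exists_extend hρ.commute h1
      have h2 : of ρ g (f K).1.idx ≤ (f L).1 := by rw [← hg']; exact h
      obtain ⟨g₂, hg₂, hg₂'⟩ := exists_extend hρ.commute h2
      -- The representative `g₂` serves both faces and the base vertex, so it comes from an element
      -- of `Γ'`.
      have h3 : of ρ 1 1 = of ρ g₂ 1 := by
        rw [hg₂ _ (by simp only [f, of_idx, Fin.le_def]; simp)]
        exact (hg _ le_rfl).symm
      have h4 := of_eq_of_iff.1 h3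
      rw [inv_one, one_mul, hrange] at h4
      obtain ⟨x, rfl⟩ := h4
      have hKx : K = of ρ' x K.idx := by
        conv_lhs => rw [hr K]
        rw [← hofsucc]
        change (f K).1 = _
        exact hg'.trans (hg₂ (f K).1.idx le_rfl).symm
      have hLx : L = of ρ' x L.idx := by
        conv_lhs => rw [hr L]
        rw [← hofsucc]
        exact hg₂'
      refine le_iff.2 ⟨?_, x, hKx, hLx⟩
      exact Fin.succ_le_succ_iff.1 h.1
  have hfinj : Function.Injective f := fun K L h => by
    refine CosetFace.le_antisymm ((hle K L).2 ?_) ((hle L K).2 ?_)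
    · change (f K).1 ≤ (f L).1
      rw [h]
      exact CosetFace.le_refl _
    · change (f L).1 ≤ (f K).1
      rw [h]
      exact CosetFace.le_refl _
  have hfsurj : Function.Surjective f := by
    rintro ⟨H, hH⟩
    obtain ⟨g, hg, hg'⟩ := exists_extend hρ.commute hH
    have h4 := of_eq_of_iff.1 (hg 1 le_rfl).symm
    rw [inv_one, one_mul, hrange] at h4
    obtain ⟨x, rfl⟩ := h4
    have hidx : H.idx ≠ 0 := by
      intro h0
      have h1 := hH.1
      rw [of_idx, h0, Fin.le_def] at h1
      simp at h1
    refine ⟨of ρ' x (H.idx.pred hidx), Subtype.ext ?_⟩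
    rw [hf, Fin.succ_pred]
    exact hg'.symm
  exact ⟨e.trans (RelIso.symm ⟨Equiv.ofBijective f ⟨hfinj, hfsurj⟩, fun {K L} => (hle K L).symm⟩)⟩

end VertexFigure

/-! ### Rewriting words in a group -/

section Rewriting

variable {ι G : Type*} [DecidableEq ι] [Group G]

/-- Reduce the word `out.reverse ++ inp` by the rewriting rules `R`, with a bound on the number of
steps; `out` is the part already reduced. -/
def rewriteWord (R : List (List ι × List ι)) : ℕ → List ι → List ι → List ι
  | 0, out, inp => out.reverse ++ inp
  | _ + 1, out, [] => out.reverse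
  | k + 1, out, i :: inp =>
    match R.find? fun r => r.1.reverse.isPrefixOf (i :: out) with
    | none => rewriteWord R k (i :: out) inp
    | some r => rewriteWord R k ((i :: out).drop r.1.length) (r.2 ++ inp)

theorem prod_map_rewriteWord {s : ι → G} {R : List (List ι × List ι)}
    (hR : ∀ r ∈ R, (r.1.map s).prod = (r.2.map s).prod) (k : ℕ) (out inp : List ι) :
    ((rewriteWord R k out inp).map s).prod = ((out.reverse ++ inp).map s).prod := by
  induction k generalizing out inp with
  | zero => rfl
  | succ k ih =>
    cases inp with
    | nil => simp [rewriteWord]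
    | cons i inp =>
      rw [rewriteWord]
      split
      · rw [ih]
        simp
      · next r hr =>
        rw [ih]
        have hmem := hR r (List.mem_of_find?_eq_some hr)
        have hpre := List.find?_some hr
        simp at hpre
        obtain ⟨t, ht⟩ := hpre
        have hdrop : (i :: out).drop r.1.length = t := by
          rw [← ht, List.drop_left' (by simp)]
        have hout : out.reverse ++ i :: inp = t.reverse ++ r.1 ++ inp := by
          have : (i :: out).reverse = t.reverse ++ r.1 := by rw [← ht]; simp
          rw [← this]
          simp
        rw [hdrop, hout]
        simp only [List.map_append, List.prod_append, hmem, mul_assoc]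

/-- Each rule `(u, v, x)` of the list follows from the earlier ones, since they reduce `u x` and
`v x` to the same word. -/
def checkRules (k : ℕ) : List (List ι × List ι) → List (List ι × List ι × ι) → Bool
  | _, [] => true
  | R, (u, v, x) :: rs =>
    (rewriteWord R k [] (u ++ [x]) == rewriteWord R k [] (v ++ [x])) &&
      checkRules k (R ++ [(u, v)]) rs

/-- The extra letter `x` can be cancelled on the right in a group, so equality of `u x` and `v x`
under the earlier rules proves `u = v`. -/
theorem valid_of_checkRules {s : ι → G} (k : ℕ) (rs : List (List ι × List ι × ι))
    (R : List (List ι × List ι)) (hR : ∀ r ∈ R, (r.1.map s).prod = (r.2.map s).prod)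
    (h : checkRules k R rs = true) :
    ∀ r ∈ R ++ rs.map fun r => (r.1, r.2.1), (r.1.map s).prod = (r.2.map s).prod := by
  induction rs generalizing R with
  | nil => simpa using hR
  | cons r rs ih =>
    obtain ⟨u, v, x⟩ := r
    simp only [checkRules, Bool.and_eq_true, beq_iff_eq] at h
    have huv : (u.map s).prod = (v.map s).prod := by
      have := congrArg (fun w => (w.map s).prod) h.1
      simp only [prod_map_rewriteWord hR] at this
      simpa using this
    have := ih (R ++ [(u, v)]) (by
      intro r hr
      rcases List.mem_append.1 hr with hr | hr
      · exact hR r hr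
      · rw [List.mem_singleton.1 hr]
        exact huv) h.2
    simpa using this

end Rewriting

/-! ### The Coxeter group of type `F₄` -/

namespace FourCell

open CoxeterMatrix

/-- The product of the simple reflections along a word. -/
abbrev wordProd (w : List (Fin 4)) : F₄.Group := (w.map F₄.simple).prod

/-- The defining relations of `F₄` as rewriting rules. -/
def baseRules : List (List (Fin 4) × List (Fin 4)) :=
  [([0, 0], []), ([1, 1], []), ([2, 2], []), ([3, 3], []), ([2, 0], [0, 2]), ([3, 0], [0, 3]),
    ([3, 1], [1, 3]), ([1, 0, 1], [0, 1, 0]), ([3, 2, 3], [2, 3, 2]),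
    ([2, 1, 2, 1], [1, 2, 1, 2])]

/-- The further rules of a complete rewriting system. -/
def derivedRules : List (List (Fin 4) × List (Fin 4) × Fin 4) :=
  [([3, 2, 1, 3], [2, 3, 2, 1], 1),
    ([3, 2, 1, 0, 3], [2, 3, 2, 1, 0], 0),
    ([2, 1, 0, 2, 1, 0], [1, 2, 1, 0, 2, 1], 1),
    ([3, 2, 1, 2, 3, 2], [2, 3, 2, 1, 2, 3], 3),
    ([3, 2, 1, 0, 2, 3, 2], [2, 3, 2, 1, 0, 2, 3], 0),
    ([3, 2, 1, 0, 2, 1, 3, 2, 1, 2], [2, 3, 2, 1, 0, 2, 1, 3, 2, 1], 1),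
    ([3, 2, 1, 0, 2, 1, 3, 2, 1, 0, 2], [2, 3, 2, 1, 0, 2, 1, 3, 2, 1, 0], 0),
    ([3, 2, 1, 0, 2, 1, 2, 3, 2, 1, 2, 3], [2, 3, 2, 1, 0, 2, 1, 2, 3, 2, 1, 2], 2),
    ([3, 2, 1, 0, 2, 1, 2, 3, 2, 1, 0, 2, 3], [2, 3, 2, 1, 0, 2, 1, 2, 3, 2, 1, 0, 2], 0),
    ([3, 2, 1, 0, 2, 1, 2, 3, 2, 1, 0, 2, 1, 3], [2, 3, 2, 1, 0, 2, 1, 2, 3, 2, 1, 0, 2, 1], 1),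
    ([3, 2, 1, 0, 2, 1, 2, 3, 2, 1, 0, 2, 1, 2, 3, 2],
      [2, 3, 2, 1, 0, 2, 1, 2, 3, 2, 1, 0, 2, 1, 2, 3], 3)]

theorem simple_mul_self (i : Fin 4) : F₄.simple i * F₄.simple i = 1 :=
  F₄.toCoxeterSystem.simple_mul_simple_self i

theorem baseRules_valid : ∀ r ∈ baseRules, wordProd r.1 = wordProd r.2 := by
  have sq := simple_mul_self
  have br := F₄.toCoxeterSystem.wordProd_braidWord_eq
  have h20 := br 0 2
  have h30 := br 0 3
  have h31 := br 1 3
  have h01 := br 0 1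
  have h23 := br 2 3
  have h12 := br 1 2
  simp only [CoxeterSystem.wordProd, CoxeterSystem.braidWord,
    show F₄ 0 2 = 2 from rfl, show F₄ 2 0 = 2 from rfl, show F₄ 0 3 = 2 from rfl,
    show F₄ 3 0 = 2 from rfl, show F₄ 1 3 = 2 from rfl, show F₄ 3 1 = 2 from rfl,
    show F₄ 0 1 = 3 from rfl, show F₄ 1 0 = 3 from rfl, show F₄ 2 3 = 3 from rfl,
    show F₄ 3 2 = 3 from rfl, show F₄ 1 2 = 4 from rfl, show F₄ 2 1 = 4 from rfl,
    CoxeterSystem.alternatingWord, List.concat_eq_append, List.nil_append, List.cons_append,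
    CoxeterMatrix.toCoxeterSystem_simple] at h20 h30 h31 h01 h23 h12
  simp only [baseRules, List.forall_mem_cons, List.not_mem_nil, false_imp_iff, implies_true,
    and_true]
  refine ⟨?_, ?_, ?_, ?_, h20.symm, h30.symm, h31.symm, ?_, ?_, ?_⟩
  · simpa [wordProd] using sq 0
  · simpa [wordProd] using sq 1
  · simpa [wordProd] using sq 2
  · simpa [wordProd] using sq 3
  · exact h01
  · exact h23
  · exact h12.symm

/-- A complete rewriting system for `F₄`. -/
def rules : List (List (Fin 4) × List (Fin 4)) :=
  baseRules ++ derivedRules.map fun r => (r.1, r.2.1)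

/-- Only the soundness of the rules is proved. Completeness just makes the later checks by
comparison of normal forms succeed. -/
theorem rules_valid : ∀ r ∈ rules, wordProd r.1 = wordProd r.2 :=
  valid_of_checkRules 60 derivedRules baseRules baseRules_valid (by decide +kernel)

/-- The minimal representatives of the left cosets of `⟨s_0, …, s_{l-1}⟩` in `⟨s_0, …, s_l⟩`. -/
def cosetWords : Fin 4 → List (List (Fin 4)) :=
  ![[[], [0]],
    [[], [1], [0, 1]],
    [[], [2], [1, 2], [0, 1, 2], [2, 1, 2], [0, 2, 1, 2], [1, 0, 2, 1, 2], [2, 1, 0, 2, 1, 2]],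
    [[], [3], [2, 3], [1, 2, 3], [0, 1, 2, 3], [2, 1, 2, 3], [0, 2, 1, 2, 3], [3, 2, 1, 2, 3],
      [1, 0, 2, 1, 2, 3], [0, 3, 2, 1, 2, 3], [2, 1, 0, 2, 1, 2, 3], [1, 0, 3, 2, 1, 2, 3],
      [3, 2, 1, 0, 2, 1, 2, 3], [2, 1, 0, 3, 2, 1, 2, 3], [2, 3, 2, 1, 0, 2, 1, 2, 3],
      [1, 2, 1, 0, 3, 2, 1, 2, 3], [1, 2, 3, 2, 1, 0, 2, 1, 2, 3],
      [0, 1, 2, 1, 0, 3, 2, 1, 2, 3], [0, 1, 2, 3, 2, 1, 0, 2, 1, 2, 3],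
      [2, 1, 2, 3, 2, 1, 0, 2, 1, 2, 3], [0, 2, 1, 2, 3, 2, 1, 0, 2, 1, 2, 3],
      [1, 0, 2, 1, 2, 3, 2, 1, 0, 2, 1, 2, 3], [2, 1, 0, 2, 1, 2, 3, 2, 1, 0, 2, 1, 2, 3],
      [3, 2, 1, 0, 2, 1, 2, 3, 2, 1, 0, 2, 1, 2, 3]]]

/-- Reduction to normal form. -/
abbrev normalForm (w : List (Fin 4)) : List (Fin 4) := rewriteWord rules 60 [] w

theorem wordProd_eq_of_normalForm_eq {u v : List (Fin 4)} (h : normalForm u = normalForm v) :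
    wordProd u = wordProd v := by
  have := congrArg wordProd h
  simpa only [prod_map_rewriteWord rules_valid, wordProd, normalForm, List.reverse_nil,
    List.nil_append] using this

/-- A generator times a coset representative is a representative, possibly followed by one generator
of the smaller subgroup. The lower bound `k` on the letters lets a single table serve all intervals
`[k,l]`. -/
theorem cosetWords_closed : ∀ l k : Fin 4, ∀ w ∈ cosetWords l, (∀ i ∈ w, k ≤ i) →
    ∀ i, k ≤ i → i ≤ l → ∃ w' ∈ cosetWords l, (∀ i ∈ w', k ≤ i) ∧
      (normalForm (i :: w) = normalForm w' ∨
        ∃ j, k ≤ j ∧ j < l ∧ normalForm (i :: w) = normalForm (w' ++ [j])) := by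
  decide +kernel

/-- Left coset representatives for consecutive standard subgroups. -/
theorem exists_cosetWord (k l : Fin 4) {w : F₄.Group}
    (hw : w ∈ Subgroup.closure (F₄.simple '' Set.Icc k l)) :
    ∃ f ∈ cosetWords l, ∃ b ∈ Subgroup.closure (F₄.simple '' Set.Ico k l), w = wordProd f * b := by
  suffices h : ∃ f ∈ cosetWords l, (∀ i ∈ f, k ≤ i) ∧
      ∃ b ∈ Subgroup.closure (F₄.simple '' Set.Ico k l), w = wordProd f * b by
    obtain ⟨f, hf, -, h⟩ := h
    exact ⟨f, hf, h⟩
  refine closure_image_induction_left simple_mul_self (p := fun w => ∃ f ∈ cosetWords l,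
    (∀ i ∈ f, k ≤ i) ∧ ∃ b ∈ Subgroup.closure (F₄.simple '' Set.Ico k l), w = wordProd f * b)
    ?_ ?_ hw
  · have : ∀ l, [] ∈ cosetWords l := by decide
    exact ⟨[], this l, by simp, 1, one_mem _, by simp [wordProd]⟩
  · rintro x - i ⟨hki, hil⟩ ⟨f, hf, hfk, b, hb, rfl⟩
    obtain ⟨f', hf', hfk', h | ⟨j, hkj, hjl, h⟩⟩ := cosetWords_closed l k f hf hfk i hki hil
    · refine ⟨f', hf', hfk', b, hb, ?_⟩
      rw [← wordProd_eq_of_normalForm_eq h]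
      simp [wordProd, mul_assoc]
    · refine ⟨f', hf', hfk', F₄.simple j * b,
        mul_mem (mem_closure_image_of_mem ⟨hkj, hjl⟩) hb, ?_⟩
      have := wordProd_eq_of_normalForm_eq h
      simp only [wordProd, List.map_cons, List.prod_cons, List.map_append, List.prod_append,
        List.map_nil, List.prod_nil, mul_one] at this
      rw [← mul_assoc, this, mul_assoc]

end FourCell

/-! ### The modular reflection groups -/

open Matrix in
-- Row vectors are linear functionals on the root lattice, and `y i` is the value at `b_i`. A
-- functional vanishing at `b_i` is unchanged by `r_i`, which is why rows rather than columns detect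
-- parabolic subgroups.
theorem vecMul_reduce_rootReflection {n : ℕ} (a : Fin n → ℕ) (d : ℕ) (i : Fin n)
    (y : Fin n → ZMod d) :
    y ᵥ* (reduce n d (rootReflection a i)).val = fun j => y j + y i * (cartanInt a i j : ZMod d) := by
  have h : (reduce n d (rootReflection a i)).val =
      1 + vecMulVec (Pi.single i 1) (fun j => (cartanInt a i j : ZMod d)) := by
    ext k j
    simp only [reduce, GeneralLinearGroup.map_apply, rootReflection, reflMatrix, Matrix.add_apply,
      vecMulVec_apply, Pi.single_apply, one_apply]
    split_ifs <;> simp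
  rw [h, vecMul_add, vecMul_one, vecMul_vecMulVec]
  ext j
  simp

namespace modGroup

open Matrix

variable {n : ℕ} {a : Fin n → ℕ} {d : ℕ}

theorem coe_modGen (i : Fin n) :
    (modGen a d i : GeneralLinearGroup (Fin n) (ZMod d)) = reduce n d (rootReflection a i) := rfl

theorem modGen_mul_self (i : Fin n) : modGen a d i * modGen a d i = 1 := by
  apply Subtype.ext
  rw [Subgroup.coe_mul, coe_modGen, ← map_mul]
  have : rootReflection a i * rootReflection a i = 1 := Units.ext (reflMatrix_mul_self a i)
  rw [this, map_one]
  rfl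

theorem closure_range_modGen : Subgroup.closure (Set.range (modGen a d)) = ⊤ := by
  have hinj : Function.Injective (modGroup a d).subtype := Subtype.val_injective
  apply Subgroup.map_injective hinj
  rw [MonoidHom.map_closure, ← MonoidHom.range_eq_map, Subgroup.range_subtype, ← Set.range_comp]
  change _ = (linGroup a).map (reduce n d)
  rw [linGroup, MonoidHom.map_closure, ← Set.range_comp]
  rfl

/-- The row vector `e_l` is fixed by all the reflections `r_i` with `i ≠ l`. -/
theorem single_vecMul_of_mem_closure {S : Set (Fin n)} {l : Fin n} (hl : l ∉ S)
    {g : modGroup a d} (hg : g ∈ Subgroup.closure (modGen a d '' S)) :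
    (Pi.single l 1 : Fin n → ZMod d) ᵥ* g.1.val = Pi.single l 1 := by
  refine closure_image_induction_right modGen_mul_self
    (p := fun g => (Pi.single l 1 : Fin n → ZMod d) ᵥ* g.1.val = Pi.single l 1) ?_ ?_ hg
  · simp
  · intro x _ i hi hx
    rw [Subgroup.coe_mul, Units.val_mul, ← vecMul_vecMul, hx, coe_modGen,
      vecMul_reduce_rootReflection]
    have : i ≠ l := fun h => hl (h ▸ hi)
    simp [this]

theorem modGen_ne_one (hd : 2 < d) (i : Fin n) : modGen a d i ≠ 1 := by
  intro h
  have h1 : (Pi.single i 1 : Fin n → ZMod d) ᵥ* (modGen a d i).1.val = Pi.single i 1 := by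
    rw [h]
    simp
  rw [coe_modGen, vecMul_reduce_rootReflection] at h1
  have h2 := congrFun h1 i
  simp only [Pi.single_eq_same, one_mul, add_eq_left, cartanInt, if_true] at h2
  rw [ZMod.intCast_zmod_eq_zero_iff_dvd] at h2
  have := Int.le_of_dvd (by norm_num) ((dvd_neg).1 h2)
  omega

theorem reflMatrix_commute {i j : Fin n} (hij : (i : ℕ) + 2 ≤ j) :
    reflMatrix a i * reflMatrix a j = reflMatrix a j * reflMatrix a i := by
  have hne : i ≠ j := by
    rintro rfl
    omega
  have h1 : cartanInt a i j = 0 := by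
    rw [cartanInt, if_neg hne, if_neg]
    omega
  have h2 : cartanInt a j i = 0 := by
    rw [cartanInt, if_neg hne.symm, if_neg]
    omega
  simp only [reflMatrix, mul_add, add_mul, one_mul, mul_one, vecMulVec_mul_vecMulVec,
    dotProduct_single, h1, h2]
  simp
  abel

theorem modGen_commute (i j : Fin n) (hij : (i : ℕ) + 2 ≤ j) :
    Commute (modGen a d i) (modGen a d j) := by
  apply Subtype.ext
  rw [Subgroup.coe_mul, Subgroup.coe_mul, coe_modGen, coe_modGen, ← map_mul, ← map_mul]
  congr 1
  exact Units.ext (reflMatrix_commute hij)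

end modGroup

/-! ### The vertex-figure group -/

namespace BasicSystem

open Matrix CoxeterMatrix modGroup

instance : Fintype BasicSystem := ⟨{.a, .b, .c, .d}, fun D => by cases D <;> simp⟩

theorem reflMatrix_pow_eq_one : ∀ (D : BasicSystem) (i j : Fin 4),
    (reflMatrix D.labels i.succ * reflMatrix D.labels j.succ) ^ F₄ i j = 1 := by
  decide +kernel

variable (D : BasicSystem) (d : ℕ)

theorem isLiftable_modGen : F₄.IsLiftable fun i : Fin 4 => modGen D.labels d i.succ := by
  intro i j
  apply Subtype.ext
  rw [Subgroup.coe_pow, Subgroup.coe_mul, coe_modGen, coe_modGen, ← map_mul, ← map_pow]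
  have : (rootReflection D.labels i.succ * rootReflection D.labels j.succ) ^ F₄ i j = 1 := by
    apply Units.ext
    rw [Units.val_pow_eq_pow_val, Units.val_mul]
    exact reflMatrix_pow_eq_one D i j
  rw [this, map_one]
  rfl

/-- The homomorphism from the Coxeter group `F₄` onto the group of the base vertex. -/
noncomputable def vertexHom : F₄.Group →* modGroup D.labels d :=
  F₄.toCoxeterSystem.lift ⟨fun i => modGen D.labels d i.succ, D.isLiftable_modGen d⟩

theorem vertexHom_simple (i : Fin 4) : D.vertexHom d (F₄.simple i) = modGen D.labels d i.succ :=
  F₄.toCoxeterSystem.lift_apply_simple (D.isLiftable_modGen d) i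

/-- The action of a word of reflections on an integral row vector. -/
def rowWord (a : Fin 5 → ℕ) (y : Fin 5 → ℤ) : List (Fin 4) → Fin 5 → ℤ
  | [] => y
  | i :: w => rowWord a (fun j => y j + y i.succ * cartanInt a i.succ j) w

theorem vecMul_vertexHom_wordProd (y : Fin 5 → ℤ) (w : List (Fin 4)) :
    (fun j => (y j : ZMod d)) ᵥ* (D.vertexHom d (FourCell.wordProd w)).1.val =
      fun j => (rowWord D.labels y w j : ZMod d) := by
  induction w generalizing y with
  | nil => simp [FourCell.wordProd, rowWord]
  | cons i w ih =>
    rw [FourCell.wordProd, List.map_cons, List.prod_cons, map_mul, Subgroup.coe_mul, Units.val_mul,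
      ← vecMul_vecMul, vertexHom_simple, coe_modGen, vecMul_reduce_rootReflection, rowWord, ← ih]
    congr 1
    ext j
    push_cast
    rfl

/-- This is where `d > 2` comes from: the coordinate found is nonzero of absolute value at most `2`,
so it cannot vanish modulo such a `d`. -/
theorem exists_rowWord_sub : ∀ (D : BasicSystem) (l : Fin 4), ∀ w ∈ FourCell.cosetWords l,
    w ≠ [] → ∃ j, (rowWord D.labels (Pi.single l.succ 1) w j -
      (Pi.single l.succ 1 : Fin 5 → ℤ) j).natAbs ∈ [1, 2] := by
  decide +kernel

variable {d}

/-- In the standard subgroups of `F₄`, the elements fixing the row vector `e_{l+1}` modulo `d` are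
generated by the reflections other than `s_l`. -/
theorem mem_closure_of_single_vecMul (hd : 2 < d) {k l : Fin 4} {w : F₄.Group}
    (hw : w ∈ Subgroup.closure (F₄.simple '' Set.Icc k l))
    (hfix : (Pi.single l.succ 1 : Fin 5 → ZMod d) ᵥ* (D.vertexHom d w).1.val = Pi.single l.succ 1) :
    w ∈ Subgroup.closure (F₄.simple '' Set.Ico k l) := by
  obtain ⟨f, hf, b, hb, rfl⟩ := FourCell.exists_cosetWord k l hw
  have hbfix : (Pi.single l.succ 1 : Fin 5 → ZMod d) ᵥ* (D.vertexHom d b⁻¹).1.val =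
      Pi.single l.succ 1 := by
    refine single_vecMul_of_mem_closure (S := Fin.succ '' Set.Ico k l) ?_ ?_
    · rintro ⟨i, hi, h⟩
      exact hi.2.ne (Fin.succ_injective _ h)
    · rw [← map_closure_image (D.vertexHom_simple d)]
      exact ⟨_, inv_mem hb, rfl⟩
  have hfun : (fun j => ((Pi.single l.succ 1 : Fin 5 → ℤ) j : ZMod d)) =
      (Pi.single l.succ 1 : Fin 5 → ZMod d) := by
    ext j
    simp only [Pi.single_apply]
    split_ifs <;> simp
  have hffix : (Pi.single l.succ 1 : Fin 5 → ZMod d) ᵥ*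
      (D.vertexHom d (FourCell.wordProd f)).1.val = Pi.single l.succ 1 := by
    have : FourCell.wordProd f = FourCell.wordProd f * b * b⁻¹ := by group
    rw [this, map_mul, Subgroup.coe_mul, Units.val_mul, ← vecMul_vecMul, hfix, hbfix]
  -- The factor `b` fixes `e_{l+1}`, hence so does the coset representative `f`, which must then be
  -- the empty word.
  by_cases hnil : f = []
  · simpa [hnil, FourCell.wordProd] using hb
  · exfalso
    obtain ⟨j, hj⟩ := exists_rowWord_sub D l f hf hnil
    rw [← hfun, vecMul_vertexHom_wordProd] at hffix
    have h1 := congrFun hffix j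
    rw [← sub_eq_zero, ← Int.cast_sub, ZMod.intCast_zmod_eq_zero_iff_dvd, ← Int.natAbs_dvd_natAbs,
      Int.natAbs_natCast] at h1
    simp only [List.mem_cons, List.not_mem_nil, or_false] at hj
    have := Nat.le_of_dvd (by omega) h1
    omega

/-- An element of the kernel fixes every row vector, so it descends through the parabolic subgroups
one generator at a time down to the trivial group. -/
theorem vertexHom_injective (hd : 2 < d) : Function.Injective (D.vertexHom d) := by
  rw [injective_iff_map_eq_one]
  intro w hw
  have hfix : ∀ l : Fin 4, (Pi.single l.succ 1 : Fin 5 → ZMod d) ᵥ* (D.vertexHom d w).1.val =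
      Pi.single l.succ 1 := by
    intro l
    rw [hw]
    simp
  have h3 : w ∈ Subgroup.closure (F₄.simple '' Set.Icc 0 3) := by
    rw [(by ext i; simp; omega : (Set.Icc 0 3 : Set (Fin 4)) = Set.univ), Set.image_univ]
    have := F₄.toCoxeterSystem.subgroup_closure_range_simple
    rw [CoxeterMatrix.toCoxeterSystem_simple] at this
    rw [this]
    trivial
  have step : ∀ l l' : Fin 4, (l' : ℕ) + 1 = l → w ∈ Subgroup.closure (F₄.simple '' Set.Icc 0 l) →
      w ∈ Subgroup.closure (F₄.simple '' Set.Icc 0 l') := by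
    intro l l' h hl
    refine closure_image_mono ?_ (D.mem_closure_of_single_vecMul hd hl (hfix l))
    intro i hi
    have := hi.2
    simp only [Set.mem_Icc, Fin.le_def, Fin.lt_def] at this ⊢
    omega
  have h0 := D.mem_closure_of_single_vecMul hd (step 1 0 rfl (step 2 1 rfl (step 3 2 rfl h3)))
    (hfix 0)
  simpa using h0

theorem isStringCGroup (hd : 2 < d) : IsStringCGroup (modGen D.labels d) where
  generate := closure_range_modGen
  involution i := orderOf_eq_prime (by rw [pow_two, modGen_mul_self]) (modGen_ne_one hd i)
  commute := modGen_commute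
  intersection := by
    refine closure_inf_closure_of_intervals modGen_commute fun k l hkl => ?_
    rintro g ⟨hg, hg'⟩
    have hfix := single_vecMul_of_mem_closure (l := l) (by simp) hg
    -- Indices in `(k,l]` are at least `1`, so the second group lies in the group of the base vertex
    -- and the element lifts to `F₄`. No information about the facet group is needed.
    obtain ⟨l, rfl⟩ := Fin.exists_succ_eq.2 (Fin.ne_zero_of_lt hkl)
    have hk : (k : ℕ) < 4 := by
      have h1 : (k : ℕ) < l + 1 := hkl
      omega
    have hIoc : Set.Ioc k l.succ = Fin.succ '' Set.Icc ⟨k, hk⟩ l := by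
      ext i
      simp only [Set.mem_Ioc, Set.mem_image, Set.mem_Icc, Fin.lt_def, Fin.le_def]
      constructor
      · rintro ⟨h1, h2⟩
        obtain ⟨i, rfl⟩ := Fin.exists_succ_eq.2 (Fin.ne_zero_of_lt (show k < i from h1))
        refine ⟨i, ⟨?_, ?_⟩, rfl⟩
        · simp at h1 ⊢; omega
        · simp at h2 ⊢; omega
      · rintro ⟨i, ⟨h1, h2⟩, rfl⟩
        simp at h1 h2 ⊢
        omega
    rw [hIoc, ← map_closure_image (D.vertexHom_simple d)] at hg'
    obtain ⟨w, hw, rfl⟩ := hg'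
    have := D.mem_closure_of_single_vecMul hd hw hfix
    have h2 : D.vertexHom d w ∈ Subgroup.closure
        (modGen D.labels d '' (Fin.succ '' Set.Ico ⟨k, hk⟩ l)) := by
      rw [← map_closure_image (D.vertexHom_simple d)]
      exact ⟨w, this, rfl⟩
    refine closure_image_mono ?_ h2
    rintro _ ⟨i, ⟨h3, h4⟩, rfl⟩
    rw [Fin.le_def] at h3
    rw [Fin.lt_def] at h4
    rw [Set.mem_Ioo, Fin.lt_def, Fin.lt_def, Fin.val_succ, Fin.val_succ]
    simp only at h3
    omega

end BasicSystem

/-! ### The symmetries of the cubical tessellation -/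

/-- The map `x ↦ v + ε · (x ∘ σ⁻¹)` of `ℤ³`, where `σ` permutes the coordinates and `ε` is a choice
of signs. -/
@[ext]
structure CubeSym where
  v : Fin 3 → ℤ
  ε : Fin 3 → ℤˣ
  σ : Equiv.Perm (Fin 3)

namespace CubeSym

instance : DecidableEq CubeSym := fun _ _ => decidable_of_iff _ CubeSym.ext_iff.symm

instance : Mul CubeSym where
  mul a b := ⟨fun i => a.v i + a.ε i * b.v (a.σ.symm i), fun i => a.ε i * b.ε (a.σ.symm i), a.σ * b.σ⟩

instance : One CubeSym where
  one := ⟨0, 1, 1⟩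

instance : Inv CubeSym where
  inv a := ⟨fun i => -(a.ε (a.σ i) * a.v (a.σ i)), fun i => a.ε (a.σ i), a.σ.symm⟩

theorem mul_def (a b : CubeSym) : a * b =
    ⟨fun i => a.v i + a.ε i * b.v (a.σ.symm i), fun i => a.ε i * b.ε (a.σ.symm i), a.σ * b.σ⟩ := rfl

theorem symm_mul_apply (σ τ : Equiv.Perm (Fin 3)) (i : Fin 3) :
    (σ * τ).symm i = τ.symm (σ.symm i) := rfl

@[simp] theorem symm_one_apply (i : Fin 3) : (1 : Equiv.Perm (Fin 3)).symm i = i := rfl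

theorem one_def : (1 : CubeSym) = ⟨0, 1, 1⟩ := rfl

theorem inv_def (a : CubeSym) :
    a⁻¹ = ⟨fun i => -(a.ε (a.σ i) * a.v (a.σ i)), fun i => a.ε (a.σ i), a.σ.symm⟩ := rfl

instance : Group CubeSym :=
  Group.ofLeftAxioms
    (fun a b c => by
      simp only [mul_def, CubeSym.mk.injEq, symm_mul_apply, Units.val_mul, mul_assoc, and_true]
      ext i
      ring)
    (fun a => by simp [mul_def, one_def])
    (fun a => by
      simp only [mul_def, inv_def, one_def, CubeSym.mk.injEq, Equiv.symm_symm]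
      refine ⟨?_, ?_, ?_⟩
      · ext i
        simp
      · ext i
        simp
      · ext i
        simp)

/-- The action on doubled coordinates. -/
def act (a : CubeSym) (z : Fin 3 → ℤ) : Fin 3 → ℤ :=
  fun i => 2 * a.v i + a.ε i * z (a.σ.symm i)

theorem act_mul (a b : CubeSym) (z : Fin 3 → ℤ) : (a * b).act z = a.act (b.act z) := by
  ext i
  simp only [act, mul_def, symm_mul_apply, Units.val_mul]
  ring

theorem act_one (z : Fin 3 → ℤ) : (1 : CubeSym).act z = z := by
  ext i
  simp [act, one_def]

theorem act_inv_act (a : CubeSym) (z : Fin 3 → ℤ) : a⁻¹.act (a.act z) = z := by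
  rw [← act_mul, inv_mul_cancel, act_one]

/-- The translation by `v`. -/
def trans (v : Fin 3 → ℤ) : CubeSym := ⟨v, 1, 1⟩

theorem act_trans (v z : Fin 3 → ℤ) : (trans v).act z = fun i => 2 * v i + z i := by
  ext i
  simp [act, trans]

theorem trans_mul (v w : Fin 3 → ℤ) : trans v * trans w = trans (v + w) := by
  ext i <;> simp [trans, mul_def]

/-- The four reflections generating the symmetry group. -/
def gen : Fin 4 → CubeSym :=
  ![⟨0, ![-1, 1, 1], 1⟩, ⟨0, 1, Equiv.swap 0 1⟩, ⟨0, 1, Equiv.swap 1 2⟩,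
    ⟨![0, 0, -1], ![1, 1, -1], 1⟩]

theorem gen_mul_self : ∀ i, gen i * gen i = 1 := by decide +kernel

/-- The doubled center of the base face of rank `j`. -/
def baseCenter (j : Fin 4) : Fin 3 → ℤ := fun i => if (i : ℕ) < j then 0 else -1

theorem act_gen_baseCenter : ∀ i j : Fin 4, i ≠ j → (gen i).act (baseCenter j) = baseCenter j := by
  decide +kernel

theorem act_baseCenter_of_mem {j : Fin 4} {a : CubeSym}
    (ha : a ∈ Subgroup.closure (gen '' {i | i ≠ j})) : a.act (baseCenter j) = baseCenter j := by
  refine closure_image_induction_right gen_mul_self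
    (p := fun a => a.act (baseCenter j) = baseCenter j) (act_one _) ?_ ha
  intro x _ i hi hx
  rw [act_mul, act_gen_baseCenter i j hi, hx]

/-- A word for the reflection of the coordinate `i` that fixes the base face of rank `j`. -/
def flipWord (j : Fin 4) (i : Fin 3) : List (Fin 4) :=
  if (i : ℕ) < j then ![[0], [1, 0, 1], [2, 1, 0, 1, 2]] i
  else ![[1, 2, 3, 2, 1], [2, 3, 2], [3]] i

/-- A word for the product of the reflections of the coordinates with negative sign. -/
def signWord (j : Fin 4) (ε : Fin 3 → ℤˣ) : List (Fin 4) :=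
  (List.finRange 3).flatMap fun i => if ε i = 1 then [] else flipWord j i

theorem ne_of_mem_signWord : ∀ (j : Fin 4) (ε : Fin 3 → ℤˣ), ∀ x ∈ signWord j ε, x ≠ j := by
  decide +kernel

/-- The stabilizer of the base face consists of sign changes about its center followed by coordinate
permutations preserving `{i | i < j}`. In doubled coordinates the center is `0` or `-1`, and
reversing a coordinate about `-1` requires the translation part `-1`. -/
theorem exists_permWord : ∀ (j : Fin 4) (ε : Fin 3 → ℤˣ) (σ : Equiv.Perm (Fin 3)),
    (∀ i : Fin 3, (i : ℕ) < j ↔ ((σ.symm i : Fin 3) : ℕ) < j) →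
    ∃ w ∈ [[], [1], [2], [1, 2], [2, 1], [1, 2, 1]], (∀ x ∈ w, x ≠ j) ∧
      ((signWord j ε ++ w).map gen).prod =
        ⟨fun i => if (i : ℕ) < j then 0 else if ε i = 1 then 0 else -1, ε, σ⟩ := by
  decide +kernel

/-- The stabilizer of a base face is generated by the reflections fixing it. -/
theorem mem_closure_of_act_baseCenter {j : Fin 4} {a : CubeSym}
    (ha : a.act (baseCenter j) = baseCenter j) : a ∈ Subgroup.closure (gen '' {i | i ≠ j}) := by
  have hcoord : ∀ i, 2 * a.v i + a.ε i * (if ((a.σ.symm i : Fin 3) : ℕ) < j then 0 else -1) =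
      if (i : ℕ) < j then 0 else -1 := fun i => congrFun ha i
  have hpar : ∀ i : Fin 3, (i : ℕ) < j ↔ ((a.σ.symm i : Fin 3) : ℕ) < j := by
    intro i
    have h := hcoord i
    rcases Int.units_eq_one_or (a.ε i) with hε | hε <;> rw [hε] at h <;> split_ifs at h with h1 h2 h2
    all_goals first
      | simp [h1, h2]; done
      | (exfalso; simp at h; omega)
  have hv : a = ⟨fun i => if (i : ℕ) < j then 0 else if a.ε i = 1 then 0 else -1, a.ε, a.σ⟩ := by
    ext i
    · have h := hcoord i
      simp only [← hpar i] at h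
      change a.v i = if (i : ℕ) < j then 0 else if a.ε i = 1 then 0 else -1
      rcases Int.units_eq_one_or (a.ε i) with hε | hε <;> rw [hε] at h <;> rw [hε] <;>
        by_cases hi : (i : ℕ) < j <;> simp [hi] at h ⊢ <;> omega
    · rfl
    · rfl
  obtain ⟨w, -, hw, hprod⟩ := exists_permWord j a.ε a.σ hpar
  rw [hv, ← hprod]
  refine list_prod_mem fun x hx => ?_
  obtain ⟨i, hi, rfl⟩ := List.mem_map.1 hx
  refine mem_closure_image_of_mem ?_
  rcases List.mem_append.1 hi with hi | hi
  · exact ne_of_mem_signWord j a.ε i hi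
  · exact hw i hi

/-- The generated group contains all translations, which are transitive on vertices, and the full
stabilizer of the base vertex. -/
theorem closure_range_gen : Subgroup.closure (Set.range gen) = ⊤ := by
  rw [← Set.image_univ]
  have htrans1 : ∀ i : Fin 3, trans (Pi.single i 1) ∈ Subgroup.closure (gen '' Set.univ) := by
    -- Two parallel mirrors, through `0` and `-1` in doubled coordinates, compose to a unit
    -- translation.
    have h : ∀ i : Fin 3, (([flipWord 3 i, flipWord 0 i].flatten).map gen).prod =
        trans (Pi.single i 1) := by
      decide +kernel
    intro i
    rw [← h i]
    refine list_prod_mem fun x hx => ?_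
    obtain ⟨k, -, rfl⟩ := List.mem_map.1 hx
    exact mem_closure_image_of_mem trivial
  let T : (Multiplicative (Fin 3 → ℤ)) →* CubeSym :=
    { toFun := fun v => trans v.toAdd
      map_one' := rfl
      map_mul' := fun v w => (trans_mul _ _).symm }
  have htrans : ∀ v, trans v ∈ Subgroup.closure (gen '' Set.univ) := by
    intro v
    have hv : Multiplicative.ofAdd v =
        ∏ i, (Multiplicative.ofAdd (Pi.single i 1 : Fin 3 → ℤ)) ^ v i := by
      apply Multiplicative.toAdd.injective
      rw [toAdd_prod]
      simp only [toAdd_zpow, toAdd_ofAdd]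
      ext k
      simp [Finset.sum_apply, Pi.single_apply]
    change T (Multiplicative.ofAdd v) ∈ _
    rw [hv, Fin.prod_univ_three, map_mul, map_mul, map_zpow, map_zpow, map_zpow]
    exact mul_mem (mul_mem (zpow_mem (htrans1 0) _) (zpow_mem (htrans1 1) _))
      (zpow_mem (htrans1 2) _)
  rw [eq_top_iff]
  intro a _
  have hodd : ∃ v : Fin 3 → ℤ, a.act (baseCenter 0) = fun i => 2 * v i + baseCenter 0 i := by
    refine ⟨fun i => a.v i + if a.ε i = 1 then 0 else 1, ?_⟩
    ext i
    simp only [act, baseCenter]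
    rcases Int.units_eq_one_or (a.ε i) with hε | hε <;> rw [hε] <;> simp
    ring
  obtain ⟨v, hv⟩ := hodd
  have h1 : ((trans v)⁻¹ * a).act (baseCenter 0) = baseCenter 0 := by
    rw [act_mul, hv, ← act_trans, act_inv_act]
  have h2 := closure_image_mono (Set.subset_univ _) (mem_closure_of_act_baseCenter h1)
  have : a = trans v * ((trans v)⁻¹ * a) := by group
  rw [this]
  exact mul_mem (htrans v) h2

/-! ### Cells and their doubled centers -/

end CubeSym

namespace CubeCell

open CubeSym

/-- The doubled center of a cell, with respect to the point with all coordinates `1/2`. -/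
def center (C : CubeCell 3) : Fin 3 → ℤ :=
  fun i => 2 * C.base i + (if i ∈ C.dirs then 1 else 0) - 1

theorem mem_dirs_iff (C : CubeCell 3) (i : Fin 3) : i ∈ C.dirs ↔ 2 ∣ C.center i := by
  simp only [center]
  split_ifs with h
  · simp [h]
  · simp only [h, false_iff]
    omega

theorem center_add_iff {C E : CubeCell 3} {v : Fin 3 → ℤ} :
    (E.center = fun i => 2 * v i + C.center i) ↔ C.dirs = E.dirs ∧ E.base - C.base = v := by
  constructor
  · intro h
    have hdirs : C.dirs = E.dirs := by
      ext i
      rw [mem_dirs_iff, mem_dirs_iff, h]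
      simp only
      omega
    refine ⟨hdirs, ?_⟩
    ext i
    have := congrFun h i
    simp only [center, hdirs] at this
    simp only [Pi.sub_apply]
    omega
  · rintro ⟨h1, rfl⟩
    ext i
    simp only [center, h1, Pi.sub_apply]
    ring

theorem exists_center_eq (z : Fin 3 → ℤ) : ∃ C : CubeCell 3, C.center = z := by
  refine ⟨⟨fun i => (z i + 1) / 2, Finset.univ.filter fun i => 2 ∣ z i⟩, ?_⟩
  ext i
  simp only [center, Finset.mem_filter, Finset.mem_univ, true_and]
  split_ifs <;> omega

theorem le_iff_center {C E : CubeCell 3} : C ≤ E ↔ ∀ i, C.center i = E.center i ∨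
    (2 ∣ E.center i ∧ (C.center i = E.center i + 1 ∨ C.center i = E.center i - 1)) := by
  have h : C ≤ E ↔ ∀ i, E.base i ≤ C.base i ∧ C.corner i ≤ E.corner i :=
    ⟨fun h i => ⟨h.1 i, h.2 i⟩, fun h => ⟨fun i => (h i).1, fun i => (h i).2⟩⟩
  rw [h]
  refine forall_congr' fun i => ?_
  simp only [← mem_dirs_iff]
  simp only [corner, center]
  split_ifs <;> simp_all <;> omega

theorem card_dirs_eq {C : CubeCell 3} {a : CubeSym} {j : Fin 4}
    (h : C.center = a.act (baseCenter j)) : C.dirs.card = j := by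
  have hd : C.dirs = (Finset.univ.filter fun i : Fin 3 => (i : ℕ) < j).map a.σ.toEmbedding := by
    ext i
    rw [mem_dirs_iff, h, Finset.mem_map_equiv]
    simp only [act, baseCenter, Finset.mem_filter, Finset.mem_univ, true_and]
    rcases Int.units_eq_one_or (a.ε i) with hε | hε <;> rw [hε] <;> split_ifs with h1 <;>
      simp [h1]
  have hcard : ∀ j : Fin 4, (Finset.univ.filter fun i : Fin 3 => (i : ℕ) < j).card = j := by
    decide
  rw [hd, Finset.card_map, hcard]

theorem exists_perm_of_subset : ∀ X Y : Finset (Fin 3), X ⊆ Y → ∃ σ : Equiv.Perm (Fin 3),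
    (∀ i, σ i ∈ X ↔ (i : ℕ) < X.card) ∧ ∀ i, σ i ∈ Y ↔ (i : ℕ) < Y.card := by
  decide +kernel

/-- The symmetry group is transitive on pairs of incident cells of given ranks. -/
theorem exists_act_eq_of_le {C E : CubeCell 3} (h : C ≤ E) {j k : Fin 4} (hj : C.dirs.card = j)
    (hk : E.dirs.card = k) :
    ∃ a : CubeSym, C.center = a.act (baseCenter j) ∧ E.center = a.act (baseCenter k) := by
  rw [le_iff_center] at h
  have hsub : C.dirs ⊆ E.dirs := by
    intro i
    rw [mem_dirs_iff, mem_dirs_iff]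
    have := h i
    omega
  obtain ⟨σ, hσ, hσ'⟩ := exists_perm_of_subset _ _ hsub
  -- The base centers have coordinate `0` in the directions of the cell and `-1` elsewhere, so
  -- matching `E` fixes the translation part. The sign is `-1` exactly where `C` lies at the upper
  -- end of `E`.
  refine ⟨⟨fun i => if i ∈ E.dirs then E.center i / 2 else (E.center i + 1) / 2,
    fun i => if C.center i = E.center i + 1 then -1 else 1, σ⟩, ?_, ?_⟩
  · ext i
    have h1 := hσ (σ.symm i)
    have h2 := hσ' (σ.symm i)
    simp only [Equiv.apply_symm_apply, hj, hk] at h1 h2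
    simp only [act, baseCenter, ← h1]
    simp only [mem_dirs_iff]
    have := h i
    split_ifs <;> simp <;> omega
  · ext i
    have h1 := hσ (σ.symm i)
    have h2 := hσ' (σ.symm i)
    simp only [Equiv.apply_symm_apply, hj, hk] at h1 h2
    simp only [act, baseCenter, ← h2]
    simp only [mem_dirs_iff]
    have := h i
    split_ifs <;> simp <;> omega

theorem le_of_center_eq {C E : CubeCell 3} {a : CubeSym} {j k : Fin 4} (hjk : j ≤ k)
    (hC : C.center = a.act (baseCenter j)) (hE : E.center = a.act (baseCenter k)) : C ≤ E := by
  rw [le_iff_center, hC, hE]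
  intro i
  simp only [act, baseCenter]
  have : (j : ℕ) ≤ k := hjk
  rcases Int.units_eq_one_or (a.ε i) with hε | hε <;> rw [hε] <;> split_ifs <;> simp <;> omega

end CubeCell

/-! ### Facets isomorphic to cubic toroids -/

section Facet

open CosetFace CubeSym

variable {Γ : Type*} [Group Γ] {ρ : Fin 5 → Γ} {q : Fin 3 → ℤ} {φ : CubeSym →* Γ}

/-- The index in a `5`-polytope of a face of rank `j ≤ 3`. -/
def rankIdx (j : Fin 4) : Fin 7 := ⟨j + 1, by omega⟩

theorem exists_rankIdx {i : Fin 7} (h0 : i ≠ 0) (h5 : i < 5) : ∃ j, rankIdx j = i := by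
  have h1 : (i : ℕ) ≠ 0 := fun h => h0 (Fin.ext h)
  have h2 : (i : ℕ) < 5 := h5
  exact ⟨⟨i - 1, by omega⟩, Fin.ext (by simp [rankIdx]; omega)⟩

theorem mem_faceSubgroup_five_iff (hφ : ∀ i, φ (gen i) = ρ i.castSucc) (g : Γ) :
    g ∈ faceSubgroup ρ 5 ↔ ∃ a, φ a = g := by
  have := map_closure_image hφ Set.univ
  rw [Set.image_univ, closure_range_gen, Set.image_univ] at this
  rw [← MonoidHom.mem_range, MonoidHom.range_eq_map, this, faceSubgroup]
  have hS : {i : Fin 5 | (i : ℕ) + 1 ≠ (5 : Fin 7)} = Set.range Fin.castSucc := by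
    ext i
    revert i
    simp only [Set.mem_ofPred_eq, Set.mem_range]
    decide
  rw [hS]

theorem map_mem_faceSubgroup_iff (hρ : IsStringCGroup ρ) (hφ : ∀ i, φ (gen i) = ρ i.castSucc)
    (j : Fin 4) (a : CubeSym) : φ a ∈ faceSubgroup ρ (rankIdx j) ↔
      ∃ b ∈ Subgroup.closure (gen '' {i | i ≠ j}), φ b = φ a := by
  have h1 : φ a ∈ faceSubgroup ρ (rankIdx j) ↔
      φ a ∈ faceSubgroup ρ 5 ⊓ faceSubgroup ρ (rankIdx j) :=
    ⟨fun h => ⟨(mem_faceSubgroup_five_iff hφ _).2 ⟨a, rfl⟩, h⟩, fun h => h.2⟩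
  have hS : {i : Fin 5 | (i : ℕ) + 1 ≠ (5 : Fin 7) ∧ (i : ℕ) + 1 ≠ rankIdx j} =
      Fin.castSucc '' {i : Fin 4 | i ≠ j} := by
    ext i
    simp only [Set.mem_ofPred_eq, Set.mem_image, rankIdx]
    clear h1
    revert i j
    decide
  rw [h1, hρ.faceSubgroup_inf, hS, ← map_closure_image hφ]
  rfl

/-- Two representatives give the same face if and only if the corresponding cells are
equivalent. -/
theorem of_map_eq_iff (hρ : IsStringCGroup ρ) (hφ : ∀ i, φ (gen i) = ρ i.castSucc)
    (hker : ∀ a, φ a = 1 ↔ ∃ v ∈ typeLattice q, a = trans v) {j : Fin 4} {a b : CubeSym}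
    {C E : CubeCell 3} (hC : C.center = a.act (baseCenter j))
    (hE : E.center = b.act (baseCenter j)) :
    of ρ (φ a) (rankIdx j) = of ρ (φ b) (rankIdx j) ↔ (cellSetoid q).r C E := by
  rw [of_eq_of_iff, ← map_inv, ← map_mul, map_mem_faceSubgroup_iff hρ hφ]
  change _ ↔ C.dirs = E.dirs ∧ E.base - C.base ∈ typeLattice q
  constructor
  · rintro ⟨y, hy, hyab⟩
    have h1 : φ (b * (a * y)⁻¹) = 1 := by
      simp only [map_mul, map_inv] at hyab ⊢
      rw [hyab]
      group
    obtain ⟨v, hv, h2⟩ := (hker _).1 h1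
    -- Since `y` fixes the base center, `a * y` has the same cell as `a`; the cells of `a` and `b`
    -- therefore differ by the lattice vector `v`.
    have h3 : b = trans v * (a * y) := by rw [← h2]; group
    have h4 : E.center = fun i => 2 * v i + C.center i := by
      rw [hE, h3, act_mul, act_mul, act_baseCenter_of_mem hy, ← hC, act_trans]
    obtain ⟨h5, h6⟩ := CubeCell.center_add_iff.1 h4
    exact ⟨h5, h6 ▸ hv⟩
  · rintro ⟨hd, hv⟩
    have h4 := CubeCell.center_add_iff.2 ⟨hd, rfl⟩
    rw [← act_trans, hE, hC, ← act_mul] at h4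
    have h5 : ((trans (E.base - C.base) * a)⁻¹ * b).act (baseCenter j) = baseCenter j := by
      rw [act_mul, h4, act_inv_act]
    refine ⟨_, mem_closure_of_act_baseCenter h5, ?_⟩
    have h6 : φ (trans (E.base - C.base)) = 1 := (hker _).2 ⟨_, hv, rfl⟩
    simp only [map_mul, map_inv, h6, one_mul]

/-- The facets of the polytope of a string C-group are cubic toroids if the group of the base facet
is the quotient of the symmetry group of the cubical tessellation by the lattice. -/
theorem IsStringCGroup.nonempty_facet_iso (hρ : IsStringCGroup ρ)
    (hφ : ∀ i, φ (gen i) = ρ i.castSucc)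
    (hker : ∀ a, φ a = 1 ↔ ∃ v ∈ typeLattice q, a = trans v) (F : CosetFace ρ) (hF : F.rk = 4) :
    Nonempty ({H // H ≤ F} ≃o CubicToroid q) := by
  have hF5 : F.idx = 5 := by
    simp only [CosetFace.rk] at hF
    apply Fin.ext
    change (F.idx : ℕ) = 5
    omega
  obtain ⟨e⟩ := F.nonempty_lower_iso
  rw [hF5] at e
  have hcommon : ∀ (g : Γ) (H : CosetFace ρ), H = of ρ g H.idx → of ρ 1 5 = of ρ g 5 →
      ∃ a, H = of ρ (φ a) H.idx ∧ φ a = g := by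
    intro g H h1 h2
    have h3 := of_eq_of_iff.1 h2
    rw [inv_one, one_mul, mem_faceSubgroup_five_iff hφ] at h3
    obtain ⟨a, rfl⟩ := h3
    exact ⟨a, h1, rfl⟩
  have hbase : ∀ (a : CubeSym) (i : Fin 7), i ≤ 5 → of ρ (φ a) i ≤ of ρ 1 5 := by
    intro a i hi
    rw [← of_mul_eq (g := 1) ((mem_faceSubgroup_five_iff hφ _).2 ⟨a, rfl⟩), one_mul]
    exact of_le_of hi
  have hle5 : ∀ j, rankIdx j ≤ 5 := by decide
  let dim : CubeCell 3 → Fin 4 := fun C =>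
    ⟨C.dirs.card, Nat.lt_succ_iff.2 ((Finset.card_le_univ _).trans (by simp))⟩
  have hrefl : ∀ C : CubeCell 3, C ≤ C := fun C => ⟨_root_.le_refl _, _root_.le_refl _⟩
  choose r hr using fun C : CubeCell 3 =>
    CubeCell.exists_act_eq_of_le (hrefl C) (j := dim C) (k := dim C) rfl rfl
  have hdim : ∀ {C E : CubeCell 3}, (cellSetoid q).r C E → dim C = dim E := by
    intro C E h
    apply Fin.ext
    change C.dirs.card = E.dirs.card
    rw [h.1]
  have hcell : ∀ (C : CubeCell 3) (a : CubeSym) (j : Fin 4), C.center = a.act (baseCenter j) →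
      of ρ (φ (r C)) (rankIdx (dim C)) = of ρ (φ a) (rankIdx j) := by
    intro C a j hC
    have hj : dim C = j := Fin.ext (CubeCell.card_dirs_eq hC)
    subst hj
    exact (of_map_eq_iff hρ hφ hker (hr C).1 hC).2 ((cellSetoid q).refl' C)
  let f₀ : ToroidCell q → CosetFace ρ :=
    Quotient.lift (fun C => of ρ (φ (r C)) (rankIdx (dim C))) fun C E h => by
      have hE := (hr E).1
      rw [← hdim h] at hE
      exact ((of_map_eq_iff hρ hφ hker (hr C).1 hE).2 h).trans (hcell E _ _ hE).symm
  have hf₀ : ∀ (C : CubeCell 3) (a : CubeSym) (j : Fin 4), C.center = a.act (baseCenter j) →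
      f₀ (Quotient.mk _ C) = of ρ (φ a) (rankIdx j) := hcell
  have hf₀idx : ∀ x, ∃ j, (f₀ x).idx = rankIdx j := by
    rintro ⟨C⟩
    exact ⟨dim C, rfl⟩
  have hf₀le : ∀ x, f₀ x ≤ of ρ 1 5 := by
    rintro ⟨C⟩
    exact hbase _ _ (hle5 _)
  have hf₀inj : ∀ x y, f₀ x = f₀ y → x = y := by
    rintro ⟨C⟩ ⟨E⟩ h
    change of ρ (φ (r C)) (rankIdx (dim C)) = of ρ (φ (r E)) (rankIdx (dim E)) at h
    have h1 : dim C = dim E := by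
      have := congrArg (fun H : CosetFace ρ => (H.idx : ℕ)) h
      simp only [of_idx, rankIdx] at this
      exact Fin.ext (by omega)
    have hE := (hr E).1
    rw [← h1] at hE h
    exact Quotient.sound ((of_map_eq_iff hρ hφ hker (hr C).1 hE).1 h)
  have hf₀mono : ∀ x y, x ≤ y ↔ f₀ x ≤ f₀ y := by
    intro x y
    constructor
    · rintro ⟨C, E, rfl, rfl, hCE⟩
      obtain ⟨a, hC, hE⟩ := CubeCell.exists_act_eq_of_le hCE (j := dim C) (k := dim E) rfl rfl
      rw [hf₀ C a _ hC, hf₀ E a _ hE]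
      refine of_le_of ?_
      have hsub : C.dirs ⊆ E.dirs := by
        intro i
        rw [CubeCell.mem_dirs_iff, CubeCell.mem_dirs_iff]
        have := CubeCell.le_iff_center.1 hCE i
        omega
      rw [Fin.le_def]
      simp only [rankIdx, dim]
      exact Nat.succ_le_succ (Finset.card_le_card hsub)
    · intro h
      obtain ⟨hi, g, hg, hg'⟩ := le_iff.1 h
      have h1 := hf₀le y
      rw [hg'] at h1
      -- A representative of both faces is adjusted to represent the base facet too, so that it
      -- comes from a symmetry of the tessellation, whose base cells give the required incident
      -- pair.
      obtain ⟨g', hgg', h5⟩ := exists_extend hρ.commute h1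
      rw [← hgg' _ hi] at hg
      rw [← hgg' _ (_root_.le_refl _)] at hg'
      obtain ⟨a, ha, rfl⟩ := hcommon g' _ hg h5
      obtain ⟨j, hj⟩ := hf₀idx x
      obtain ⟨k, hk⟩ := hf₀idx y
      obtain ⟨C, hC⟩ := CubeCell.exists_center_eq (a.act (baseCenter j))
      obtain ⟨E, hE⟩ := CubeCell.exists_center_eq (a.act (baseCenter k))
      refine ⟨C, E, hf₀inj _ _ ?_, hf₀inj _ _ ?_, CubeCell.le_of_center_eq ?_ hC hE⟩
      · rw [hf₀ C a j hC, hg, hj]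
      · rw [hf₀ E a k hE, hg', hk]
      · rw [hj, hk, Fin.le_def] at hi
        simp only [rankIdx] at hi
        rw [Fin.le_def]
        omega
  have h05 : of ρ 1 0 ≤ of ρ 1 5 := of_le_of (Fin.zero_le _)
  let f : CubicToroid q → {H // H ≤ of ρ 1 5} := fun x =>
    WithBot.recBotCoe ⟨of ρ 1 0, h05⟩
      (fun y => WithTop.recTopCoe ⟨of ρ 1 5, CosetFace.le_refl _⟩ (fun z => ⟨f₀ z, hf₀le z⟩) y) x
  have hbot : ∀ H : CosetFace ρ, of ρ 1 0 ≤ H := by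
    intro H
    obtain ⟨g, hg⟩ := H.exists_eq_of
    rw [← hρ.eq_of_idx_zero (of ρ g 0) rfl 1, hg]
    exact of_le_of (Fin.zero_le _)
  have hfinj : Function.Injective f := by
    intro x y h
    have h' := congrArg Subtype.val h
    have hidx := congrArg (fun H : CosetFace ρ => (H.idx : ℕ)) h'
    induction x using WithBot.recBotCoe with
    | bot =>
      induction y using WithBot.recBotCoe with
      | bot => rfl
      | coe y =>
        exfalso
        induction y using WithTop.recTopCoe with
        | top => exact absurd (show (0 : ℕ) = 5 from hidx) (by decide)
        | coe z =>
          obtain ⟨j, hj⟩ := hf₀idx z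
          change 0 = ((f₀ z).idx : ℕ) at hidx
          simp [hj, rankIdx] at hidx
    | coe x =>
      induction y using WithBot.recBotCoe with
      | bot =>
        exfalso
        induction x using WithTop.recTopCoe with
        | top => exact absurd (show (5 : ℕ) = 0 from hidx) (by decide)
        | coe z =>
          obtain ⟨j, hj⟩ := hf₀idx z
          change ((f₀ z).idx : ℕ) = 0 at hidx
          simp [hj, rankIdx] at hidx
      | coe y =>
        congr 1
        induction x using WithTop.recTopCoe with
        | top =>
          induction y using WithTop.recTopCoe with
          | top => rfl
          | coe z =>
            exfalso
            obtain ⟨j, hj⟩ := hf₀idx z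
            change 5 = ((f₀ z).idx : ℕ) at hidx
            rw [hj, rankIdx] at hidx
            simp only at hidx
            omega
        | coe w =>
          induction y using WithTop.recTopCoe with
          | top =>
            exfalso
            obtain ⟨j, hj⟩ := hf₀idx w
            change ((f₀ w).idx : ℕ) = 5 at hidx
            rw [hj, rankIdx] at hidx
            simp only at hidx
            omega
          | coe z =>
            congr 1
            exact hf₀inj _ _ h'
  have hfsurj : Function.Surjective f := by
    rintro ⟨H, hH⟩
    by_cases h0 : H.idx = 0
    · exact ⟨⊥, Subtype.ext (hρ.eq_of_idx_zero H h0 1).symm⟩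
    by_cases h5 : H.idx = 5
    · exact ⟨WithBot.some (⊤ : WithTop (ToroidCell q)), Subtype.ext (eq_of_le_of_idx_eq hH h5).symm⟩
    obtain ⟨j, hj⟩ := exists_rankIdx h0 (lt_of_le_of_ne hH.1 h5)
    obtain ⟨-, g, hg, hg'⟩ := le_iff.1 hH
    obtain ⟨a, ha, -⟩ := hcommon g H hg hg'
    obtain ⟨C, hC⟩ := CubeCell.exists_center_eq (a.act (baseCenter j))
    refine ⟨WithBot.some (WithTop.some (Quotient.mk _ C : ToroidCell q)), Subtype.ext ?_⟩
    refine (hf₀ C a j hC).trans ?_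
    rw [hj]
    exact ha.symm
  have hfle : ∀ x y, x ≤ y ↔ f x ≤ f y := by
    intro x y
    induction x using WithBot.recBotCoe with
    | bot => exact iff_of_true bot_le (hbot _)
    | coe x =>
      induction y using WithBot.recBotCoe with
      | bot =>
        refine iff_of_false (WithBot.not_coe_le_bot _) fun h => ?_
        have h1 : ((f x).1.idx : ℕ) ≤ 0 := h.1
        induction x using WithTop.recTopCoe with
        | top => exact absurd (show (5 : ℕ) ≤ 0 from h1) (by decide)
        | coe z =>
          obtain ⟨j, hj⟩ := hf₀idx z
          change ((f₀ z).idx : ℕ) ≤ 0 at h1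
          simp [hj, rankIdx] at h1
      | coe y =>
        rw [WithBot.coe_le_coe]
        induction y using WithTop.recTopCoe with
        | top => exact iff_of_true le_top (f x).2
        | coe z =>
          induction x using WithTop.recTopCoe with
          | top =>
            refine iff_of_false (WithTop.not_top_le_coe _) fun h => ?_
            obtain ⟨j, hj⟩ := hf₀idx z
            have h1 : 5 ≤ ((f₀ z).idx : ℕ) := h.1
            rw [hj, rankIdx] at h1
            simp only at h1
            omega
          | coe w =>
            rw [WithTop.coe_le_coe]
            exact hf₀mono w z
  exact ⟨e.trans (RelIso.symm ⟨Equiv.ofBijective f ⟨hfinj, hfsurj⟩, fun {x y} => (hfle x y).symm⟩)⟩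

end Facet

/-! ### The linear representation of the symmetry group of the cubical tessellation -/

namespace CubeSym

/-- The action on `ℤ ⊕ ℤ³ ⊕ ℤ` by isometries of the form of signature `(4, 1)`; the first summand is
spanned by an isotropic vector. -/
def lin (a : CubeSym) (p : ℤ × (Fin 3 → ℤ) × ℤ) : ℤ × (Fin 3 → ℤ) × ℤ :=
  (p.1 - ∑ k, (2 * a.v k * a.ε k + a.ε k - 1) * p.2.1 (a.σ.symm k) +
      p.2.2 * ∑ k, (a.v k ^ 2 + a.v k),
    fun k => a.ε k * p.2.1 (a.σ.symm k) - p.2.2 * a.v k, p.2.2)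

theorem lin_one (p : ℤ × (Fin 3 → ℤ) × ℤ) : lin 1 p = p := by
  simp [lin, one_def]

theorem lin_mul (a b : CubeSym) (p : ℤ × (Fin 3 → ℤ) × ℤ) : lin (a * b) p = lin a (lin b p) := by
  obtain ⟨α, x, β⟩ := p
  simp only [lin, mul_def, symm_mul_apply, Units.val_mul, Prod.mk.injEq, and_true]
  constructor
  · have h1 := Equiv.sum_comp a.σ.symm
      fun k => (2 * b.v k * b.ε k + b.ε k - 1) * x (b.σ.symm k)
    have h2 := Equiv.sum_comp a.σ.symm fun k => (b.v k ^ 2 + b.v k)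
    rw [← h1, ← h2, Finset.mul_sum, Finset.mul_sum, Finset.mul_sum]
    -- Once the sums belonging to `b` are reindexed by the permutation of `a`, the identity holds
    -- term by term, using that the signs square to `1`.
    suffices h : ∀ k, -((2 * (a.v k + a.ε k * b.v (a.σ.symm k)) * (a.ε k * b.ε (a.σ.symm k)) +
          a.ε k * b.ε (a.σ.symm k) - 1) * x (b.σ.symm (a.σ.symm k))) +
        β * ((a.v k + a.ε k * b.v (a.σ.symm k)) ^ 2 + (a.v k + a.ε k * b.v (a.σ.symm k))) =
        -((2 * b.v (a.σ.symm k) * b.ε (a.σ.symm k) + b.ε (a.σ.symm k) - 1) *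
          x (b.σ.symm (a.σ.symm k))) + β * (b.v (a.σ.symm k) ^ 2 + b.v (a.σ.symm k)) -
        (2 * a.v k * a.ε k + a.ε k - 1) * (b.ε (a.σ.symm k) * x (b.σ.symm (a.σ.symm k)) -
          β * b.v (a.σ.symm k)) + β * (a.v k ^ 2 + a.v k) by
      have h3 := Finset.sum_congr (rfl : (Finset.univ : Finset (Fin 3)) = _) fun k _ => h k
      simp only [Finset.sum_add_distrib, Finset.sum_sub_distrib, Finset.sum_neg_distrib] at h3 ⊢
      linear_combination h3
    intro k
    rcases Int.units_eq_one_or (a.ε k) with hε | hε <;> rw [hε] <;> push_cast <;> ring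
  · ext k
    ring

end CubeSym

namespace BasicSystem

open Matrix CubeSym modGroup

/-- The factor by which the first basis vector is scaled. -/
def headScale : BasicSystem → ℤ
  | .a => 1
  | .b => 1
  | .c => 2
  | .d => 2

/-- The factor by which the last two basis vectors are scaled. -/
def tailScale : BasicSystem → ℤ
  | .a => 2
  | .b => 1
  | .c => 2
  | .d => 1

/-- The embedding of the root lattice. -/
def embed (D : BasicSystem) (y : Fin 5 → ℤ) : ℤ × (Fin 3 → ℤ) × ℤ :=
  (D.headScale * y 0, ![y 1 - D.headScale * y 0, y 2 - y 1, D.tailScale * y 3 - y 2],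
    D.tailScale * y 4)

variable (D : BasicSystem)

theorem headScale_ne_zero : D.headScale ≠ 0 := by cases D <;> decide

theorem tailScale_ne_zero : D.tailScale ≠ 0 := by cases D <;> decide

theorem embed_eq_iff {y : Fin 5 → ℤ} {p : ℤ × (Fin 3 → ℤ) × ℤ} : D.embed y = p ↔
    D.headScale * y 0 = p.1 ∧ y 1 - D.headScale * y 0 = p.2.1 0 ∧ y 2 - y 1 = p.2.1 1 ∧
      D.tailScale * y 3 - y 2 = p.2.1 2 ∧ D.tailScale * y 4 = p.2.2 := by
  obtain ⟨α, x, β⟩ := p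
  simp only [embed, Prod.mk.injEq, funext_iff, Fin.forall_fin_succ]
  simp [and_assoc]

theorem embed_injective : Function.Injective D.embed := by
  intro y z h
  obtain ⟨h0, h1, h2, h3, h4⟩ := D.embed_eq_iff.1 h
  simp only [embed, cons_val_zero, cons_val_one, cons_val] at h0 h1 h2 h3 h4
  have e0 := mul_left_cancel₀ D.headScale_ne_zero h0
  have e1 : y 1 = z 1 := by rw [e0] at h1; linarith
  have e2 : y 2 = z 2 := by linarith
  have e3 := mul_left_cancel₀ D.tailScale_ne_zero (show D.tailScale * y 3 = _ * z 3 by linarith)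
  have e4 := mul_left_cancel₀ D.tailScale_ne_zero h4
  ext i
  fin_cases i
  exacts [e0, e1, e2, e3, e4]

theorem reflMatrix_mulVec {n : ℕ} (a : Fin n → ℕ) (i : Fin n) (y : Fin n → ℤ) :
    reflMatrix a i *ᵥ y = fun k => y k + if k = i then ∑ j, cartanInt a i j * y j else 0 := by
  rw [reflMatrix, add_mulVec, one_mulVec, vecMulVec_mulVec]
  ext k
  simp [Pi.single_apply, dotProduct]

/-- With `δ` the isotropic vector and `h`, `t` the two scales, `b_0, …, b_3` go to `h(δ - e_1)`,
`e_1 - e_2`, `e_2 - e_3`, `t e_3`. These are roots of the walls of the fundamental simplex of the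
cubical tessellation, and scaling a root does not alter its reflection. -/
theorem embed_reflMatrix (i : Fin 4) (y : Fin 5 → ℤ) :
    D.embed (reflMatrix D.labels i.castSucc *ᵥ y) = (gen i).lin (D.embed y) := by
  rw [reflMatrix_mulVec, embed_eq_iff]
  cases D <;> fin_cases i <;>
    simp [lin, gen, embed, headScale, tailScale, Fin.sum_univ_succ, cartanInt, labels,
      Equiv.swap_apply_def] <;> omega

/-- The embedding may have proper image, so integrality of the matrix of `a` is inherited from the
generators rather than obtained by inverting the embedding. -/
theorem exists_lin_eq (a : CubeSym) : ∃ M : GeneralLinearGroup (Fin 5) ℤ, M ∈ linGroup D.labels ∧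
    ∀ y, D.embed (M.val *ᵥ y) = a.lin (D.embed y) := by
  have ha : a ∈ Subgroup.closure (gen '' Set.univ) := by
    rw [Set.image_univ, closure_range_gen]
    trivial
  refine closure_image_induction_left gen_mul_self (p := fun a => ∃ M : GeneralLinearGroup (Fin 5) ℤ,
    M ∈ linGroup D.labels ∧ ∀ y, D.embed (M.val *ᵥ y) = a.lin (D.embed y)) ?_ ?_ ha
  · exact ⟨1, one_mem _, fun y => by rw [Units.val_one, one_mulVec, lin_one]⟩
  · rintro x - i - ⟨M, hM, hMy⟩
    refine ⟨rootReflection D.labels i.castSucc * M,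
      mul_mem (Subgroup.subset_closure (Set.mem_range_self _)) hM, fun y => ?_⟩
    rw [Units.val_mul, ← mulVec_mulVec, lin_mul, ← hMy]
    exact D.embed_reflMatrix i _

theorem eq_of_embed_mulVec_eq {M N : GeneralLinearGroup (Fin 5) ℤ}
    (h : ∀ y, D.embed (M.val *ᵥ y) = D.embed (N.val *ᵥ y)) : M = N := by
  apply Units.ext
  apply Matrix.toLin'.injective
  ext1 y
  exact LinearMap.ext fun z => D.embed_injective (h _)

/-- The integral matrix of a symmetry of the cubical tessellation. -/
noncomputable def facetMatrix (a : CubeSym) : GeneralLinearGroup (Fin 5) ℤ :=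
  (D.exists_lin_eq a).choose

theorem facetMatrix_mem (a : CubeSym) : D.facetMatrix a ∈ linGroup D.labels :=
  (D.exists_lin_eq a).choose_spec.1

theorem embed_facetMatrix (a : CubeSym) (y : Fin 5 → ℤ) :
    D.embed ((D.facetMatrix a).val *ᵥ y) = a.lin (D.embed y) :=
  (D.exists_lin_eq a).choose_spec.2 y

theorem facetMatrix_mul (a b : CubeSym) :
    D.facetMatrix (a * b) = D.facetMatrix a * D.facetMatrix b := by
  refine D.eq_of_embed_mulVec_eq fun y => ?_
  rw [embed_facetMatrix, Units.val_mul, ← mulVec_mulVec, embed_facetMatrix, embed_facetMatrix,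
    lin_mul]

theorem facetMatrix_gen (i : Fin 4) :
    D.facetMatrix (gen i) = rootReflection D.labels i.castSucc := by
  refine D.eq_of_embed_mulVec_eq fun y => ?_
  rw [embed_facetMatrix, ← embed_reflMatrix]
  rfl

/-- The homomorphism from the symmetry group of the cubical tessellation onto the group of the
base facet. -/
noncomputable def facetHom (d : ℕ) : CubeSym →* modGroup D.labels d :=
  MonoidHom.mk' (fun a => ⟨reduce 5 d (D.facetMatrix a),
    Subgroup.mem_map_of_mem _ (D.facetMatrix_mem a)⟩) fun a b => by
      apply Subtype.ext
      rw [Subgroup.coe_mul]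
      simp only [facetMatrix_mul, map_mul]

theorem facetHom_gen (d : ℕ) (i : Fin 4) :
    D.facetHom d (gen i) = modGen D.labels d i.castSucc := by
  apply Subtype.ext
  change reduce 5 d (D.facetMatrix (gen i)) = _
  rw [facetMatrix_gen]
  rfl

theorem facetHom_eq_one_iff (d : ℕ) (a : CubeSym) : D.facetHom d a = 1 ↔
    ∀ j i, (d : ℤ) ∣ (D.facetMatrix a).val i j - (1 : Matrix (Fin 5) (Fin 5) ℤ) i j := by
  rw [← Subtype.coe_inj, Subgroup.coe_one, ← Units.val_inj, ← Matrix.ext_iff, forall_comm]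
  refine forall_congr' fun j => forall_congr' fun i => ?_
  change ((D.facetMatrix a).val i j : ZMod d) = (1 : Matrix (Fin 5) (Fin 5) (ZMod d)) i j ↔ _
  rw [← ZMod.intCast_zmod_eq_zero_iff_dvd, Int.cast_sub, sub_eq_zero, one_apply, one_apply]
  push_cast
  rfl

theorem facetMatrix_col (a : CubeSym) (j : Fin 5) :
    D.embed (fun i => (D.facetMatrix a).val i j) = a.lin (D.embed (Pi.single j 1)) := by
  rw [← embed_facetMatrix, mulVec_single_one]
  rfl

end BasicSystem

namespace BasicSystem

open Matrix CubeSym modGroup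

variable (D : BasicSystem)

/-! ### The kernel of the reduction -/

/-- Besides the identity, the only isometry fixing the plane of coordinate sum zero pointwise is the
reflection in it, which is not a signed permutation. -/
theorem eq_one_of_fix : ∀ (ε : Fin 3 → ℤˣ) (σ : Equiv.Perm (Fin 3)),
    (∀ k, (ε k : ℤ) * (![1, -1, 0] : Fin 3 → ℤ) (σ.symm k) = (![1, -1, 0] : Fin 3 → ℤ) k ∧
      (ε k : ℤ) * (![0, 1, -1] : Fin 3 → ℤ) (σ.symm k) = (![0, 1, -1] : Fin 3 → ℤ) k) →
    ε = 1 ∧ σ = 1 := by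
  decide +kernel

theorem eq_of_dvd_sub {d : ℕ} (hd : 2 < d) {x y : ℤ} (hx : x ∈ [-1, 0, 1]) (hy : y ∈ [-1, 0, 1])
    (h : (d : ℤ) ∣ x - y) : x = y := by
  by_contra hne
  have h0 : x - y ≠ 0 := sub_ne_zero.2 hne
  have h1 := Int.le_of_dvd (abs_pos.2 h0) ((dvd_abs _ _).2 h)
  simp only [List.mem_cons, List.not_mem_nil, or_false] at hx hy
  have h2 : |x - y| ≤ 2 := by
    rw [abs_le]
    omega
  omega

/-- The columns of `b_1` and `b_2` see only the linear part of `a`. Their embedded entries lie in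
`{-1, 0, 1}`, so congruence modulo `d > 2` is equality. -/
theorem eq_trans_of_facetHom_eq_one {d : ℕ} (hd : 2 < d) {a : CubeSym} (h : D.facetHom d a = 1) :
    a = trans a.v := by
  rw [facetHom_eq_one_iff] at h
  have hunit : ∀ (k : Fin 3) (x : Fin 3 → ℤ), (∀ l, x l ∈ [-1, 0, 1]) →
      (a.ε k : ℤ) * x (a.σ.symm k) ∈ ([-1, 0, 1] : List ℤ) := by
    intro k x hx
    have := hx (a.σ.symm k)
    simp only [List.mem_cons, List.not_mem_nil, or_false] at this ⊢
    rcases Int.units_eq_one_or (a.ε k) with hε | hε <;> rw [hε] <;> push_cast <;> omega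
  have h1 := D.embed_eq_iff.1 (D.facetMatrix_col a 1)
  have h2 := D.embed_eq_iff.1 (D.facetMatrix_col a 2)
  have e1 : D.embed (Pi.single 1 1) = (0, ![1, -1, 0], 0) := by
    rw [embed_eq_iff]
    simp
  have e2 : D.embed (Pi.single 2 1) = (0, ![0, 1, -1], 0) := by
    rw [embed_eq_iff]
    simp
  rw [e1] at h1
  rw [e2] at h2
  simp only [lin, zero_mul, sub_zero] at h1 h2
  obtain ⟨-, h10, h11, h12, -⟩ := h1
  obtain ⟨-, h20, h21, h22, -⟩ := h2
  choose t ht using h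
  have hone : ∀ i j : Fin 5, i ≠ j → (D.facetMatrix a).val i j = d * t j i := by
    intro i j hij
    have := ht j i
    rwa [one_apply_ne hij, sub_zero] at this
  have hdiag : ∀ i : Fin 5, (D.facetMatrix a).val i i = 1 + d * t i i := by
    intro i
    have := ht i i
    rw [one_apply_eq] at this
    linarith
  rw [hdiag 1, hone 0 1 (by decide)] at h10
  rw [hone 2 1 (by decide), hdiag 1] at h11
  rw [hone 3 1 (by decide), hone 2 1 (by decide)] at h12
  rw [hone 1 2 (by decide), hone 0 2 (by decide)] at h20
  rw [hdiag 2, hone 1 2 (by decide)] at h21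
  rw [hone 3 2 (by decide), hdiag 2] at h22
  have hu : ∀ l, (![1, -1, 0] : Fin 3 → ℤ) l ∈ ([-1, 0, 1] : List ℤ) := by decide
  have hu' : ∀ l, (![0, 1, -1] : Fin 3 → ℤ) l ∈ ([-1, 0, 1] : List ℤ) := by decide
  obtain ⟨hε, hσ⟩ := eq_one_of_fix a.ε a.σ fun k => by
    constructor
    · refine eq_of_dvd_sub hd (hunit k _ hu) (hu k) ?_
      fin_cases k
      · exact ⟨t 1 1 - D.headScale * t 1 0, by simp at h10 ⊢; linear_combination -h10⟩
      · exact ⟨t 1 2 - t 1 1, by simp at h11 ⊢; linear_combination -h11⟩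
      · exact ⟨D.tailScale * t 1 3 - t 1 2, by simp at h12 ⊢; linear_combination -h12⟩
    · refine eq_of_dvd_sub hd (hunit k _ hu') (hu' k) ?_
      fin_cases k
      · exact ⟨t 2 1 - D.headScale * t 2 0, by simp at h20 ⊢; linear_combination -h20⟩
      · exact ⟨t 2 2 - t 2 1, by simp at h21 ⊢; linear_combination -h21⟩
      · exact ⟨D.tailScale * t 2 3 - t 2 2, by simp at h22 ⊢; linear_combination -h22⟩
  ext i
  · rfl
  · rw [hε]
    rfl
  · rw [hσ]
    rfl

/-- The matrix of a translation, minus the identity, as a linear function of the translation vector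
`v` and two quadratic expressions `T` and `m` in its coordinates. -/
def transMatrix (w u p r : ℤ) (v : Fin 3 → ℤ) (T m : ℤ) : Matrix (Fin 5) (Fin 5) ℤ :=
  !![2 * v 0, p * (v 1 - v 0), p * (v 2 - v 1), -(p * u * v 2), m;
    2 * w * v 0, 2 * (v 1 - v 0), 2 * (v 2 - v 1), -(2 * u * v 2), u * (T - v 0);
    2 * w * v 0, 2 * (v 1 - v 0), 2 * (v 2 - v 1), -(2 * u * v 2), u * (T - v 0 - v 1);
    w * r * v 0, r * (v 1 - v 0), r * (v 2 - v 1), -(2 * v 2), T - v 0 - v 1 - v 2;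
    0, 0, 0, 0, 0]

/-- The integers `p` and `r` are `2` divided by the scales, which keeps the entries integral when
the embedding is undone. The corner entry `m` is known only through its multiple by `headScale`;
this is the source of the parity condition. -/
theorem facetMatrix_trans {p r : ℤ} (hp : D.headScale * p = 2) (hr : D.tailScale * r = 2)
    (v : Fin 3 → ℤ) : ∃ m, D.headScale * m = D.tailScale * ∑ k, (v k ^ 2 + v k) ∧
      (D.facetMatrix (trans v)).val =
        1 + transMatrix D.headScale D.tailScale p r v (∑ k, (v k ^ 2 + v k)) m := by
  have hm := (D.embed_eq_iff.1 (D.facetMatrix_col (trans v) 4)).1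
  refine ⟨(D.facetMatrix (trans v)).val 0 4, ?_, ?_⟩
  · simpa [lin, CubeSym.trans, embed, Fin.sum_univ_three] using hm
  · ext i j
    revert i
    rw [← funext_iff]
    apply D.embed_injective
    rw [D.facetMatrix_col, eq_comm, embed_eq_iff]
    generalize (D.facetMatrix (trans v)).val 0 4 = m at hm
    simp only [lin, CubeSym.trans, embed, Fin.sum_univ_three] at hm ⊢
    fin_cases j <;> simp [transMatrix, one_apply] at hm ⊢
    · refine ⟨?_, ?_, ?_⟩
      · ring
      · ring
      · linear_combination (D.headScale * v 0) * hr
    · refine ⟨?_, ?_, ?_⟩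
      · linear_combination (v 1 - v 0) * hp
      · linear_combination -(v 1 - v 0) * hp
      · linear_combination (v 1 - v 0) * hr
    · refine ⟨?_, ?_, ?_⟩
      · linear_combination (v 2 - v 1) * hp
      · linear_combination -(v 2 - v 1) * hp
      · linear_combination (v 2 - v 1) * hr
    · refine ⟨?_, ?_, ?_⟩
      · linear_combination (D.tailScale * v 2) * hp
      · linear_combination (D.tailScale * v 2) * hp
      · ring
    · refine ⟨?_, ?_, ?_, ?_⟩
      · linear_combination hm
      · linear_combination - hm
      · ring
      · ring

theorem transMatrix_smul (w u p r d : ℤ) (v : Fin 3 → ℤ) (T m : ℤ) :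
    transMatrix w u p r (fun i => d * v i) (d * T) (d * m) = d • transMatrix w u p r v T m := by
  ext i j
  fin_cases i <;> fin_cases j <;> simp [transMatrix] <;> ring

theorem mem_typeLattice_single {d : ℤ} {v : Fin 3 → ℤ} :
    v ∈ typeLattice ![d, 0, 0] ↔ ∃ c : Fin 3 → ℤ, v = fun i => d * c i := by
  constructor
  · intro h
    induction h using AddSubgroup.closure_induction with
    | mem x hx =>
      obtain ⟨σ, ε, rfl⟩ := hx
      refine ⟨fun i => ε i * (![1, 0, 0] : Fin 3 → ℤ) (σ i), ?_⟩
      have hk : ∀ k, (![d, 0, 0] : Fin 3 → ℤ) k = d * (![1, 0, 0] : Fin 3 → ℤ) k := by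
        intro k
        fin_cases k <;> simp
      ext i
      rw [hk]
      ring
    | zero => exact ⟨0, by ext; simp⟩
    | add x y _ _ hx hy =>
      obtain ⟨c, rfl⟩ := hx
      obtain ⟨c', rfl⟩ := hy
      exact ⟨c + c', by ext; simp [mul_add]⟩
    | neg x _ hx =>
      obtain ⟨c, rfl⟩ := hx
      exact ⟨-c, by ext; simp⟩
  · rintro ⟨c, rfl⟩
    have hgen : ∀ i : Fin 3, (Pi.single i d : Fin 3 → ℤ) ∈ typeLattice ![d, 0, 0] := by
      intro i
      refine AddSubgroup.subset_closure ⟨Equiv.swap 0 i, 1, ?_⟩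
      ext k
      fin_cases i <;> fin_cases k <;> simp [Equiv.swap_apply_def]
    have : (fun i => d * c i) = c 0 • (Pi.single 0 d : Fin 3 → ℤ) + c 1 • Pi.single 1 d +
        c 2 • Pi.single 2 d := by
      ext k
      fin_cases k <;> simp [mul_comm]
    rw [this]
    exact add_mem (add_mem (zsmul_mem (hgen 0) _) (zsmul_mem (hgen 1) _)) (zsmul_mem (hgen 2) _)

theorem mem_typeLattice_double {d : ℤ} {v : Fin 3 → ℤ} :
    v ∈ typeLattice ![d, d, 0] ↔
      ∃ c : Fin 3 → ℤ, 2 ∣ c 0 + c 1 + c 2 ∧ v = fun i => d * c i := by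
  constructor
  · intro h
    induction h using AddSubgroup.closure_induction with
    | mem x hx =>
      obtain ⟨σ, ε, rfl⟩ := hx
      have heven : ∀ (σ : Equiv.Perm (Fin 3)) (ε : Fin 3 → ℤˣ),
          2 ∣ (ε 0 : ℤ) * (![1, 1, 0] : Fin 3 → ℤ) (σ 0) + ε 1 * (![1, 1, 0] : Fin 3 → ℤ) (σ 1) +
            ε 2 * (![1, 1, 0] : Fin 3 → ℤ) (σ 2) := by decide +kernel
      refine ⟨fun i => ε i * (![1, 1, 0] : Fin 3 → ℤ) (σ i), heven σ ε, ?_⟩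
      have hk : ∀ k, (![d, d, 0] : Fin 3 → ℤ) k = d * (![1, 1, 0] : Fin 3 → ℤ) k := by
        intro k
        fin_cases k <;> simp
      ext i
      rw [hk]
      ring
    | zero => exact ⟨0, by simp, by ext; simp⟩
    | add x y _ _ hx hy =>
      obtain ⟨c, hc, rfl⟩ := hx
      obtain ⟨c', hc', rfl⟩ := hy
      exact ⟨c + c', by simp only [Pi.add_apply]; omega, by ext; simp [mul_add]⟩
    | neg x _ hx =>
      obtain ⟨c, hc, rfl⟩ := hx
      exact ⟨-c, by simp only [Pi.neg_apply]; omega, by ext; simp⟩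
  · rintro ⟨c, ⟨s, hs⟩, rfl⟩
    have h1 : ![d, -d, 0] ∈ typeLattice ![d, d, 0] := by
      refine AddSubgroup.subset_closure ⟨1, ![1, -1, 1], ?_⟩
      ext k
      fin_cases k <;> simp
    have h2 : ![0, d, -d] ∈ typeLattice ![d, d, 0] := by
      refine AddSubgroup.subset_closure ⟨Equiv.swap 0 2, ![1, 1, -1], ?_⟩
      ext k
      fin_cases k <;> simp [Equiv.swap_apply_def]
    have h3 : ![0, d, d] ∈ typeLattice ![d, d, 0] := by
      refine AddSubgroup.subset_closure ⟨Equiv.swap 0 2, 1, ?_⟩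
      ext k
      fin_cases k <;> simp [Equiv.swap_apply_def]
    -- Here `c 0 + c 1 + c 2 = 2 * s`; the coefficients come from solving the triangular system.
    have : (fun i => d * c i) = c 0 • ![d, -d, 0] + (c 0 + c 1 - s) • ![0, d, -d] +
        s • ![0, d, d] := by
      ext k
      fin_cases k <;> simp
      · ring
      · ring
      · linear_combination d * hs
    rw [this]
    exact add_mem (add_mem (zsmul_mem h1 _) (zsmul_mem h2 _)) (zsmul_mem h3 _)

theorem facetHom_trans_eq_one_iff (d : ℕ) (hd : 2 < d) (v : Fin 3 → ℤ) :
    D.facetHom d (trans v) = 1 ↔ ∃ (c : Fin 3 → ℤ) (s : ℤ), v = (fun i => d * c i) ∧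
      D.headScale * s = D.tailScale * ∑ k, (d * c k ^ 2 + c k) := by
  obtain ⟨p, hp⟩ : ∃ p, D.headScale * p = 2 := by
    cases D
    exacts [⟨2, rfl⟩, ⟨2, rfl⟩, ⟨1, rfl⟩, ⟨1, rfl⟩]
  obtain ⟨r, hr⟩ : ∃ r, D.tailScale * r = 2 := by
    cases D
    exacts [⟨1, rfl⟩, ⟨2, rfl⟩, ⟨1, rfl⟩, ⟨2, rfl⟩]
  obtain ⟨m, hm, hM⟩ := D.facetMatrix_trans hp hr v
  have hd0 : (d : ℤ) ≠ 0 := by omega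
  rw [facetHom_eq_one_iff, hM]
  simp only [Matrix.add_apply, add_sub_cancel_left]
  constructor
  · intro h
    choose t ht using h
    have m00 := ht 0 3
    have m01 := ht 1 0
    have m31 := ht 1 3
    have m02 := ht 2 0
    have m32 := ht 2 3
    have m04 := ht 4 0
    have m14 := ht 4 1
    have m24 := ht 4 2
    have m34 := ht 4 3
    simp [transMatrix] at m00 m01 m31 m02 m32 m04 m14 m24 m34
    have key : ∃ c : Fin 3 → ℤ, v = fun i => d * c i := by
      suffices h : ∃ c0 c1 c2, v 0 = d * c0 ∧ v 1 = d * c1 ∧ v 2 = d * c2 by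
        obtain ⟨c0, c1, c2, h0, h1, h2⟩ := h
        refine ⟨![c0, c1, c2], ?_⟩
        ext k
        fin_cases k
        exacts [h0, h1, h2]
      -- With tail scale `1` the successive differences in the last column are the coordinates of
      -- `v`. With tail scale `2` the fourth row gives `v 1 - v 0` and `v 2 - v 1`, together with `v
      -- 0` for (a). For (c) it gives only `2 * v 0`, and the last column supplies `v 0 + v 1 + v
      -- 2`, from which `v 0` follows.
      cases D <;> simp only [headScale, tailScale] at *
      · have hr1 : r = 1 := by omega
        subst hr1
        exact ⟨t 0 3, t 0 3 + t 1 3, t 0 3 + t 1 3 + t 2 3, by linarith, by linarith, by linarith⟩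
      · exact ⟨t 4 0 - t 4 1, t 4 1 - t 4 2, t 4 2 - t 4 3, by linarith, by linarith, by linarith⟩
      · have hr1 : r = 1 := by omega
        subst hr1
        have hv0 : v 0 = d * (t 4 0 - t 4 3 - 2 * t 1 3 - t 2 3 - t 0 3) := by linarith
        exact ⟨_, t 4 0 - t 4 3 - 2 * t 1 3 - t 2 3 - t 0 3 + t 1 3,
          t 4 0 - t 4 3 - 2 * t 1 3 - t 2 3 - t 0 3 + t 1 3 + t 2 3, hv0, by linarith, by linarith⟩
      · exact ⟨2 * t 4 0 - t 4 1, t 4 1 - t 4 2, t 4 2 - t 4 3,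
          by linarith, by linarith, by linarith⟩
    obtain ⟨c, rfl⟩ := key
    refine ⟨c, t 4 0, rfl, ?_⟩
    apply mul_left_cancel₀ hd0
    rw [m04] at hm
    simp only [Fin.sum_univ_three] at hm ⊢
    linear_combination hm
  · rintro ⟨c, s, rfl, hs⟩ j i
    have hT : ∑ k, ((d * c k) ^ 2 + d * c k) = d * ∑ k, (d * c k ^ 2 + c k) := by
      rw [Finset.mul_sum]
      refine Finset.sum_congr rfl fun k _ => ?_
      ring
    have hms : m = d * s := by
      apply mul_left_cancel₀ D.headScale_ne_zero
      rw [hm, hT]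
      linear_combination -d * hs
    rw [hT, hms, transMatrix_smul, Matrix.smul_apply, smul_eq_mul]
    exact dvd_mul_right _ _

/-- If `headScale` divides `tailScale` the quadratic condition is always solvable. This fails only
for (d), where `∑ (d c_k² + c_k)` must be even: automatic for odd `d`, as `c² + c` is even, and
equivalent to `∑ c_k` being even for even `d`. -/
theorem facetHom_trans_eq_one_iff_mem (d : ℕ) (hd : 2 < d) (v : Fin 3 → ℤ) :
    D.facetHom d (trans v) = 1 ↔ v ∈ typeLattice (D.typeVector d) := by
  rw [D.facetHom_trans_eq_one_iff d hd]
  by_cases hD : D = .d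
  · subst hD
    simp only [headScale, tailScale, one_mul]
    have hpar : ∀ x : ℤ, ∃ y, x ^ 2 = x + 2 * y := fun x => by
      obtain ⟨y, hy⟩ := Int.even_mul_pred_self x
      exact ⟨y, by linear_combination hy⟩
    by_cases he : Even d
    · rw [typeVector, if_pos ⟨rfl, he⟩, mem_typeLattice_double]
      obtain ⟨k, hk⟩ := he
      have hk' : (d : ℤ) = 2 * k := by push_cast [hk]; ring
      refine exists_congr fun c => ⟨?_, ?_⟩
      · rintro ⟨s, rfl, hs⟩
        refine ⟨⟨s - k * (c 0 ^ 2 + c 1 ^ 2 + c 2 ^ 2), ?_⟩, rfl⟩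
        rw [Fin.sum_univ_three] at hs
        linear_combination -hs - (c 0 ^ 2 + c 1 ^ 2 + c 2 ^ 2) * hk'
      · rintro ⟨⟨s, hs⟩, rfl⟩
        refine ⟨s + k * (c 0 ^ 2 + c 1 ^ 2 + c 2 ^ 2), rfl, ?_⟩
        rw [Fin.sum_univ_three]
        linear_combination -hs - (c 0 ^ 2 + c 1 ^ 2 + c 2 ^ 2) * hk'
    · rw [typeVector, if_neg (fun h => he h.2), mem_typeLattice_single]
      refine exists_congr fun c => ⟨fun ⟨s, h, _⟩ => h, fun h => ?_⟩
      obtain ⟨k, hk⟩ := Nat.not_even_iff_odd.1 he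
      have hk' : (d : ℤ) = 2 * k + 1 := by push_cast [hk]; ring
      choose y hy using fun k => hpar (c k)
      refine ⟨∑ i, (k * c i ^ 2 + c i + y i), h, ?_⟩
      simp only [Fin.sum_univ_three]
      linear_combination -(c 0 ^ 2 + c 1 ^ 2 + c 2 ^ 2) * hk' - hy 0 - hy 1 - hy 2
  · rw [typeVector, if_neg (fun h => hD h.1), mem_typeLattice_single]
    refine exists_congr fun c => ⟨fun ⟨s, h, _⟩ => h, fun h => ?_⟩
    obtain ⟨x, hx⟩ : ∃ x, D.tailScale = D.headScale * x := by
      cases D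
      exacts [⟨2, rfl⟩, ⟨1, rfl⟩, ⟨1, rfl⟩, absurd rfl hD]
    exact ⟨x * ∑ k, (d * c k ^ 2 + c k), h, by rw [hx]; ring⟩

theorem facetHom_eq_one_iff_mem {d : ℕ} (hd : 2 < d) (a : CubeSym) :
    D.facetHom d a = 1 ↔ ∃ v ∈ typeLattice (D.typeVector d), a = trans v := by
  constructor
  · intro h
    have ha := D.eq_trans_of_facetHom_eq_one hd h
    rw [ha] at h
    exact ⟨a.v, (D.facetHom_trans_eq_one_iff_mem d hd _).1 h, ha⟩
  · rintro ⟨v, hv, rfl⟩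
    exact (D.facetHom_trans_eq_one_iff_mem d hd v).2 hv

end BasicSystem

namespace BasicSystem

open Matrix modGroup

variable (D : BasicSystem)

/-! ### Conjugacy for odd moduli -/

/-- The diagonal matrix of scaling factors. -/
def scaling : Matrix (Fin 5) (Fin 5) ℤ :=
  diagonal ![D.headScale, 1, 1, D.tailScale, D.tailScale]

/-- The roots of each basic system are multiples, by the diagonal entries, of those of system (b),
so the reflections agree over the rationals. -/
theorem scaling_mul_reflMatrix (i : Fin 5) :
    D.scaling * reflMatrix D.labels i = reflMatrix (labels .b) i * D.scaling := by
  revert i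
  cases D <;> decide +kernel

theorem isUnit_det_scaling {d : ℕ} (hd : Odd d) :
    IsUnit (D.scaling.map (Int.cast : ℤ → ZMod d)).det := by
  have h2 : IsUnit (2 : ZMod d) := by
    have := (ZMod.isUnit_iff_coprime 2 d).2 (Nat.coprime_two_left.2 hd)
    exact_mod_cast this
  have h (z : ℤ) (hz : z = 1 ∨ z = 2) : IsUnit (z : ZMod d) := by
    rcases hz with rfl | rfl
    · simp
    · exact_mod_cast h2
  have hhead : IsUnit (D.headScale : ZMod d) := h _ (by cases D <;> decide)
  have htail : IsUnit (D.tailScale : ZMod d) := h _ (by cases D <;> decide)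
  rw [scaling, diagonal_map Int.cast_zero, det_diagonal, Fin.prod_univ_five]
  simpa using (hhead.mul htail).mul htail

/-- The scaling matrix, reduced modulo an odd number. -/
noncomputable def scalingUnit {d : ℕ} (hd : Odd d) : GeneralLinearGroup (Fin 5) (ZMod d) :=
  GeneralLinearGroup.mk'' _ (D.isUnit_det_scaling hd)

theorem scalingUnit_mul {d : ℕ} (hd : Odd d) (i : Fin 5) :
    D.scalingUnit hd * reduce 5 d (rootReflection D.labels i) =
      reduce 5 d (rootReflection (labels .b) i) * D.scalingUnit hd := by
  apply Units.ext
  have h := congrArg (fun M => M.map (Int.castRingHom (ZMod d))) (D.scaling_mul_reflMatrix i)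
  simp only [Matrix.map_mul] at h
  exact h

theorem exists_conj {d : ℕ} (hd : Odd d) (D' : BasicSystem) :
    ∃ h : GeneralLinearGroup (Fin 5) (ZMod d), ∀ i,
      h * (modGen D.labels d i).1 * h⁻¹ = (modGen D'.labels d i).1 := by
  refine ⟨(D'.scalingUnit hd)⁻¹ * D.scalingUnit hd, fun i => ?_⟩
  have h := D.scalingUnit_mul hd i
  have h' := D'.scalingUnit_mul hd i
  change _ * reduce 5 d (rootReflection D.labels i) * _ = reduce 5 d (rootReflection D'.labels i)
  rw [mul_inv_eq_iff_eq_mul, mul_assoc, h, ← mul_assoc, ← mul_assoc]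
  congr 1
  rw [inv_mul_eq_iff_eq_mul, ← mul_assoc, h', mul_inv_cancel_right]

end BasicSystem

namespace modGroup

open Matrix

theorem map_conj {n d : ℕ} {a b : Fin n → ℕ} {h : GeneralLinearGroup (Fin n) (ZMod d)}
    (hh : ∀ i, h * (modGen a d i).1 * h⁻¹ = (modGen b d i).1) :
    (modGroup a d).map (MulAut.conj h).toMonoidHom = modGroup b d := by
  simp only [modGroup, linGroup, MonoidHom.map_closure, ← Set.range_comp]
  exact congrArg (fun f => Subgroup.closure (Set.range f)) (funext hh)

/-- Conjugation as an isomorphism. -/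
noncomputable def conjEquiv {n d : ℕ} {a b : Fin n → ℕ} {h : GeneralLinearGroup (Fin n) (ZMod d)}
    (hh : ∀ i, h * (modGen a d i).1 * h⁻¹ = (modGen b d i).1) :
    modGroup a d ≃* modGroup b d :=
  ((MulAut.conj h).subgroupMap (modGroup a d)).trans (MulEquiv.subgroupCongr (map_conj hh))

end modGroup

/-! ### Finiteness and assembly of the main theorem. -/

theorem CosetFace.finite {n : ℕ} {Γ : Type*} [Group Γ] [Finite Γ] (ρ : Fin n → Γ) :
    Finite (CosetFace ρ) :=
  Finite.of_surjective (fun p : Fin (n + 2) × Γ => (⟨p.1, p.2⟩ : CosetFace ρ)) fun F => by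
    obtain ⟨j, c⟩ := F
    obtain ⟨g, rfl⟩ := QuotientGroup.mk_surjective c
    exact ⟨(j, g), rfl⟩

theorem mainTheorem6 (d : ℕ) (hd : 2 < d) :
    (∀ D : BasicSystem,
      IsStringCGroup (modGen D.labels d) ∧
      Finite (CosetFace (modGen D.labels d)) ∧
      IsRegularPolytope 5 (CosetFace (modGen D.labels d)) CosetFace.rk ∧
      (∃ φ : modGroup D.labels d ≃*
          (CosetFace (modGen D.labels d) ≃o CosetFace (modGen D.labels d)),
        ∀ (g : modGroup D.labels d) (j : Fin 7) (x : modGroup D.labels d),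
          φ g ⟨j, (x : modGroup D.labels d ⧸ faceSubgroup (modGen D.labels d) j)⟩ =
            ⟨j, ((g * x : modGroup D.labels d) :
              modGroup D.labels d ⧸ faceSubgroup (modGen D.labels d) j)⟩) ∧
      HasFacetsAndVertexFigures 5 (CosetFace (modGen D.labels d)) CosetFace.rk
        (CubicToroid (D.typeVector d)) Cell24) ∧
    (Odd d → ∀ D D' : BasicSystem,
      ∃ (h : Matrix.GeneralLinearGroup (Fin 5) (ZMod d))
        (φ : modGroup D.labels d ≃* modGroup D'.labels d),
        (∀ g : modGroup D.labels d,
          (φ g : Matrix.GeneralLinearGroup (Fin 5) (ZMod d)) = h * g * h⁻¹) ∧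
        ∀ i : Fin 5, φ (modGen D.labels d i) = modGen D'.labels d i) := by
  refine ⟨fun D => ?_, fun hodd D D' => ?_⟩
  · have hρ := D.isStringCGroup hd
    have : NeZero d := ⟨by omega⟩
    refine ⟨hρ, CosetFace.finite _, hρ.isRegularPolytope, ⟨hρ.automorphismEquiv, fun _ _ _ => rfl⟩,
      fun F hF => ?_, fun F hF => ?_⟩
    · exact hρ.nonempty_facet_iso (D.facetHom_gen d) (D.facetHom_eq_one_iff_mem hd) F
        (by rw [hF]; norm_num)
    · refine hρ.nonempty_vertexFigure_iso ?_ (D.vertexHom_injective hd) (D.vertexHom_simple d) F hF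
      have := CoxeterMatrix.F₄.toCoxeterSystem.subgroup_closure_range_simple
      simpa using this
  · obtain ⟨h, hh⟩ := D.exists_conj hodd D'
    exact ⟨h, modGroup.conjEquiv hh, fun _ => rfl, fun i => Subtype.ext (hh i)⟩
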